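/- Let $D\subset\mathbb{R}^2$ be an open set of finite measure, $\alpha>0$, $x_0\in D$, and let $R>0$ be such that $\overline{B_R}\subset D$, where $B_R$ is the open ball of centre $x_0$ and radius $R$; let $n=(x-x_0)/R$ on $\partial B_R$. Let $h\in L^2(D)$ and let $g:D\times\mathbb{R}\to\mathbb{R}$ be measurable in $x$ and such that: for every $x\in D$, $s\mapsto g(x,s)$ is $C^1$ with derivative $g_s(x,\cdot)$ Lipschitz continuous with a constant $M$ independent of $x$; $g_s(\cdot,0)\in L^2(D)$; and $g(\cdot,0)\in L^p(D)$ for some $p>1$. All boundary value problems are understood in the weak ($H^1$) sense. For $k\in L^2(B_R)$ and $\phi\in H^{1/2}(\partial B_R)$ let $v_0^{k,\phi}\in H^1(B_R)$ be the solution of $-\alpha\Delta v+v=k$ in $B_R$, $v=\phi$ on $\partial B_R$. Let $T_0\phi:=\nabla v_0^{0,\phi}\cdot n\in H^{-1/2}(\partial B_R)$ be the Dirichlet-to-Neumann operator, and put $h_0[k]:=-\nabla v_0^{k,0}\cdot n$. On $V_R:=H^1(D\setminus \overline{B_R})$ set $$a_0(v,\varphi)=\alpha\int_{D\setminus B_R}\nabla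 v\cdot\nabla\varphi\,dx+\alpha\int_{\partial B_R}T_0v\,\varphi\,d\sigma+\int_{D\setminus B_R}v\,\varphi\,dx,\qquad J_0(v)=\int_D g\big(x,\tilde v(x)\big)\,dx,$$ where $\tilde v=v$ in $D\setminus B_R$ and $\tilde v=v_0^{h,v|_{\partial B_R}}$ in $B_R$. Let $\widetilde v_0\in H^1(D)$ solve $-\alpha\Delta\widetilde v_0+\widetilde v_0=h$ in $D$, $\partial_n\widetilde v_0=0$ on $\partial D$; let $v_0\in V_R$ solve $a_0(v_0,\varphi)=\int_{D\setminus B_R}h\varphi\,dx+\alpha\int_{\partial B_R}h_0[h]\,\varphi\,d\sigma$ for all $\varphi\in V_R$; and let $\widetilde w_0\in H^1(D)$ solve $$-\alpha\Delta\widetilde w_0+\widetilde w_0=-g_s\big(\cdot,\widetilde v_0(\cdot)\big)\ \text{in } D,\qquad \partial_n\widetilde w_0=0\ \text{on }\partial D .$$ Let the adjoint state $w_0\in V_R$ be the solution of $a_0(w_0,\varphi)=-DJ_0(v_0)\varphi$ for all $\varphi\in V_R$, where $DJ_0$ is the Fréchet derivative. Then all these objects are well defined (functions in $V_R$ have a unique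 trace on $\partial B_R$, and it lies in $H^{1/2}(\partial B_R)$; each of the problems has exactly one solution; $J_0$ is Fréchet differentiable at $v_0$). The adjoint state $w_0$ is exactly the weak solution in $V_R$ of $$-\alpha\Delta w_0+w_0=-g_s(\cdot,v_0(\cdot))\ \text{in } D\setminus \overline{B_R},\qquad -\partial_nw_0+T_0w_0=h_0\big[-g_s(\cdot,\tilde v(\cdot))\big]\ \text{on }\partial B_R,\qquad \partial_nw_0=0\ \text{on }\partial D,$$ where $\tilde v$ is the extension of $v=v_0$ defined above. Moreover $w_0$ is the restriction of $\widetilde w_0$ to $D\setminus \overline{B_R}$. -/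

import Mathlib

open MeasureTheory Metric Set
open scoped ENNReal NNReal ContDiff

noncomputable section

/-- The Euclidean plane. -/
abbrev Plane : Type := EuclideanSpace ℝ (Fin 2)

/-- `ψ` is a smooth function with compact support contained in `W`. -/
structure IsTestFunction (W : Set Plane) (ψ : Plane → ℝ) : Prop where
  smooth : ContDiff ℝ ∞ ψ
  compact : HasCompactSupport ψ
  supp : tsupport ψ ⊆ W

/-- The partial derivative in the `i`-th coordinate direction. -/
def partialDeriv (i : Fin 2) (ψ : Plane → ℝ) (x : Plane) : ℝ :=
  fderiv ℝ ψ x (EuclideanSpace.single i 1)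

lemma IsTestFunction.continuous_partialDeriv {W : Set Plane} {ψ : Plane → ℝ}
    (h : IsTestFunction W ψ) (i : Fin 2) : Continuous (partialDeriv i ψ) :=
  (h.smooth.continuous_fderiv (by simp)).clm_apply continuous_const

lemma IsTestFunction.memLp {W : Set Plane} {ψ : Plane → ℝ}
    (h : IsTestFunction W ψ) (μ : Measure Plane) [IsFiniteMeasureOnCompacts μ] :
    MemLp ψ 2 μ :=
  h.smooth.continuous.memLp_of_hasCompactSupport h.compact

lemma IsTestFunction.memLp_partialDeriv {W : Set Plane} {ψ : Plane → ℝ}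
    (h : IsTestFunction W ψ) (i : Fin 2) (μ : Measure Plane) [IsFiniteMeasureOnCompacts μ] :
    MemLp (partialDeriv i ψ) 2 μ :=
  (h.continuous_partialDeriv i).memLp_of_hasCompactSupport
    (h.compact.fderiv_apply ℝ (EuclideanSpace.single i 1))

/-- `G` is the gradient of `u` on `U` in the sense of distributions. -/
def HasWeakGradient (U : Set Plane) (u : Plane → ℝ) (G : Plane → Plane) : Prop :=
  ∀ ψ : Plane → ℝ, IsTestFunction U ψ → ∀ i : Fin 2,
    ∫ x in U, u x * partialDeriv i ψ x = -∫ x in U, G x i * ψ x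

/-- The space of pairs of an `L²` function and an `L²` vector field on `U`, with the Hilbert norm
`(‖u‖² + ‖G‖²)^{1/2}`. -/
abbrev L2Pair (U : Set Plane) : Type :=
  WithLp 2 (Lp ℝ 2 (volume.restrict U) × Lp Plane 2 (volume.restrict U))

lemma integrable_mul_of_L2 {μ : Measure Plane} {a b : Plane → ℝ}
    (ha : MemLp a 2 μ) (hb : MemLp b 2 μ) : Integrable (fun x => a x * b x) μ :=
  MemLp.integrable_mul ha hb

lemma memLp_coord {μ : Measure Plane} {G : Plane → Plane} (hG : MemLp G 2 μ) (i : Fin 2) :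
    MemLp (fun x => G x i) 2 μ :=
  (EuclideanSpace.proj (𝕜 := ℝ) i : Plane →L[ℝ] ℝ).comp_memLp' hG

/-- The Sobolev space `H¹(U)`, as the space of pairs `(u, ∇u)` in `L²(U) × L²(U)²`; its norm is
`(∫ u² + ∫ |∇u|²)^{1/2}`. -/
def H1Submodule (U : Set Plane) : Submodule ℝ (L2Pair U) where
  carrier := {p | HasWeakGradient U p.fst p.snd}
  zero_mem' := by
    intro ψ _ i
    have h1 : ∀ᵐ x ∂(volume.restrict U),
        ((0 : L2Pair U).fst : Plane → ℝ) x * partialDeriv i ψ x = 0 := by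
      filter_upwards [Lp.coeFn_zero ℝ 2 (volume.restrict U)] with x hx
      exact (congrArg (· * _) hx).trans (zero_mul _)
    have h2 : ∀ᵐ x ∂(volume.restrict U),
        ((0 : L2Pair U).snd : Plane → Plane) x i * ψ x = 0 := by
      filter_upwards [Lp.coeFn_zero Plane 2 (volume.restrict U)] with x hx
      exact (congrArg (fun y : Plane => y i * ψ x) hx).trans (zero_mul _)
    rw [integral_congr_ae h1, integral_congr_ae h2]
    simp
  add_mem' := by
    intro p q hp hq ψ hψ i
    have h1 : ∀ᵐ x ∂(volume.restrict U),
        ((p + q).fst : Plane → ℝ) x * partialDeriv i ψ x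
          = p.fst x * partialDeriv i ψ x + q.fst x * partialDeriv i ψ x := by
      filter_upwards [Lp.coeFn_add p.fst q.fst] with x hx
      exact (congrArg (· * _) hx).trans (add_mul _ _ _)
    have h2 : ∀ᵐ x ∂(volume.restrict U),
        ((p + q).snd : Plane → Plane) x i * ψ x = p.snd x i * ψ x + q.snd x i * ψ x := by
      filter_upwards [Lp.coeFn_add p.snd q.snd] with x hx
      exact (congrArg (fun y : Plane => y i * ψ x) hx).trans (add_mul _ _ _)
    rw [integral_congr_ae h1, integral_congr_ae h2, integral_add, integral_add, hp ψ hψ i,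
      hq ψ hψ i, neg_add]
    · exact integrable_mul_of_L2 (memLp_coord (Lp.memLp _) i) (hψ.memLp _)
    · exact integrable_mul_of_L2 (memLp_coord (Lp.memLp _) i) (hψ.memLp _)
    · exact integrable_mul_of_L2 (Lp.memLp _) (hψ.memLp_partialDeriv i _)
    · exact integrable_mul_of_L2 (Lp.memLp _) (hψ.memLp_partialDeriv i _)
  smul_mem' := by
    intro c p hp ψ hψ i
    have h1 : ∀ᵐ x ∂(volume.restrict U),
        ((c • p).fst : Plane → ℝ) x * partialDeriv i ψ x
          = c * (p.fst x * partialDeriv i ψ x) := by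
      filter_upwards [Lp.coeFn_smul c p.fst] with x hx
      exact (congrArg (· * _) hx).trans (mul_assoc _ _ _)
    have h2 : ∀ᵐ x ∂(volume.restrict U),
        ((c • p).snd : Plane → Plane) x i * ψ x = c * (p.snd x i * ψ x) := by
      filter_upwards [Lp.coeFn_smul c p.snd] with x hx
      exact (congrArg (fun y : Plane => y i * ψ x) hx).trans (mul_assoc _ _ _)
    rw [integral_congr_ae h1, integral_congr_ae h2, integral_const_mul, integral_const_mul,
      hp ψ hψ i, mul_neg]

/-- The Sobolev space `H¹(U)` as a Hilbert space. -/
abbrev H1 (U : Set Plane) : Type := H1Submodule U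

/-- The function underlying an element of `H¹(U)` (determined almost everywhere on `U`). -/
def H1.fn {U : Set Plane} (u : H1 U) : Plane → ℝ := (u : L2Pair U).fst

/-- The weak gradient of an element of `H¹(U)`. -/
def H1.grad {U : Set Plane} (u : H1 U) : Plane → Plane := (u : L2Pair U).snd

lemma H1.memLp_fn {U : Set Plane} (u : H1 U) : MemLp u.fn 2 (volume.restrict U) :=
  Lp.memLp (u : L2Pair U).fst

lemma H1.memLp_grad {U : Set Plane} (u : H1 U) : MemLp u.grad 2 (volume.restrict U) :=
  Lp.memLp (u : L2Pair U).snd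

lemma H1.fn_sub {U : Set Plane} (u v : H1 U) :
    (u - v).fn =ᵐ[volume.restrict U] fun x => u.fn x - v.fn x :=
  Lp.coeFn_sub (u : L2Pair U).fst (v : L2Pair U).fst

lemma H1.grad_sub {U : Set Plane} (u v : H1 U) :
    (u - v).grad =ᵐ[volume.restrict U] fun x => u.grad x - v.grad x :=
  Lp.coeFn_sub (u : L2Pair U).snd (v : L2Pair U).snd

/-- Restriction of functions, `H¹(U) → H¹(V)` for `V ⊆ U`. -/
def H1.restrict {U V : Set Plane} (hVU : V ⊆ U) (u : H1 U) : H1 V :=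
  ⟨WithLp.toLp 2
      ((u.memLp_fn.mono_measure (Measure.restrict_mono hVU le_rfl)).toLp u.fn,
        (u.memLp_grad.mono_measure (Measure.restrict_mono hVU le_rfl)).toLp u.grad), by
    intro ψ hψ i
    have hz : ∀ x, x ∉ V → ψ x = 0 := fun x hx =>
      image_eq_zero_of_notMem_tsupport fun h => hx (hψ.supp h)
    have hz' : ∀ x, x ∉ V → partialDeriv i ψ x = 0 := fun x hx => by
      have h0 : fderiv ℝ ψ x = 0 := image_eq_zero_of_notMem_tsupport
        fun h => hx (hψ.supp (tsupport_fderiv_subset ℝ h))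
      simp [partialDeriv, h0]
    have key := u.2 ψ ⟨hψ.smooth, hψ.compact, hψ.supp.trans hVU⟩ i
    have h1 : ∀ᵐ x ∂(volume.restrict V),
        ((u.memLp_fn.mono_measure (Measure.restrict_mono hVU le_rfl)).toLp u.fn :
          Plane → ℝ) x * partialDeriv i ψ x = u.fn x * partialDeriv i ψ x := by
      filter_upwards [MemLp.coeFn_toLp
        (u.memLp_fn.mono_measure (Measure.restrict_mono hVU le_rfl))] with x hx
      rw [hx]
    have h2 : ∀ᵐ x ∂(volume.restrict V),
        ((u.memLp_grad.mono_measure (Measure.restrict_mono hVU le_rfl)).toLp u.grad :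
          Plane → Plane) x i * ψ x = u.grad x i * ψ x := by
      filter_upwards [MemLp.coeFn_toLp
        (u.memLp_grad.mono_measure (Measure.restrict_mono hVU le_rfl))] with x hx
      rw [hx]
    refine (integral_congr_ae h1).trans (Eq.trans ?_ (congrArg Neg.neg (integral_congr_ae h2)).symm)
    rw [setIntegral_eq_integral_of_forall_compl_eq_zero
        (fun x hx => by rw [hz' x hx, mul_zero]),
      setIntegral_eq_integral_of_forall_compl_eq_zero (fun x hx => by rw [hz x hx, mul_zero])]
    rw [setIntegral_eq_integral_of_forall_compl_eq_zero
        (fun x hx => by rw [hz' x (fun h => hx (hVU h)), mul_zero]),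
      setIntegral_eq_integral_of_forall_compl_eq_zero
        (fun x hx => by rw [hz x (fun h => hx (hVU h)), mul_zero])] at key
    exact key⟩

/-- `∫_U ∇u · ∇v dx`. -/
def gradForm {U : Set Plane} (u v : H1 U) : ℝ := ∫ x in U, inner ℝ (u.grad x) (v.grad x)

/-- `∫_U k v dx`. -/
def massForm {U : Set Plane} (k : Plane → ℝ) (v : H1 U) : ℝ := ∫ x in U, k x * v.fn x

/-- Weak solutions `u ∈ H¹(D)` of `-αΔu + u = k` in `D`, `∂ₙu = 0` on `∂D`. -/
def IsNeumannSolution (α : ℝ) (D : Set Plane) (k : Plane → ℝ) (u : H1 D) : Prop :=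
  ∀ φ : H1 D, α * gradForm u φ + massForm u.fn φ = massForm k φ

/-! ### Traces on the circle `∂B_R` -/

/-- Arc length on the circle `∂B_R` of centre `x₀` and radius `R`. -/
def arcLength (x₀ : Plane) (R : ℝ) : Measure Plane :=
  ENNReal.ofReal R •
    ((volume : Measure Plane).toSphere.map fun θ : sphere (0 : Plane) 1 => x₀ + R • (θ : Plane))

/-- `L²(∂B_R)`. -/
abbrev L2Circle (x₀ : Plane) (R : ℝ) : Type := Lp ℝ 2 (arcLength x₀ R)

/-- `f` is the trace on `∂B_R` of `u ∈ H¹(U)`: the Green formula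
`∫_U (u ∂ᵢψ + ∂ᵢu ψ) dx = ∫_{∂B_R} f ψ νᵢ dσ` holds for all smooth `ψ` with compact support in the
open set `W`, where `∂B_R` is the part of `∂U` in `W` and `ν` is the unit normal there that points
out of `U`. -/
def IsTraceOn (x₀ : Plane) (R : ℝ) {U : Set Plane} (W : Set Plane) (ν : Plane → Plane)
    (u : H1 U) (f : L2Circle x₀ R) : Prop :=
  ∀ ψ : Plane → ℝ, IsTestFunction W ψ → ∀ i : Fin 2,
    ∫ x in U, (u.fn x * partialDeriv i ψ x + u.grad x i * ψ x)
      = ∫ x, f x * ψ x * ν x i ∂(arcLength x₀ R)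

/-- `f` is the trace on `∂B_R` of `u ∈ H¹(B_R)`. -/
def IsInnerTrace {x₀ : Plane} {R : ℝ} (u : H1 (ball x₀ R)) (f : L2Circle x₀ R) : Prop :=
  IsTraceOn x₀ R univ (fun x => R⁻¹ • (x - x₀)) u f

/-- The space `H^{1/2}(∂B_R)` of traces of functions in `H¹(B_R)`. -/
def HHalf (x₀ : Plane) (R : ℝ) : Set (L2Circle x₀ R) :=
  {f | ∃ u : H1 (ball x₀ R), IsInnerTrace u f}

/-- The space `V_R = H¹(D ∖ B_R)`. -/
abbrev VR (D : Set Plane) (x₀ : Plane) (R : ℝ) : Type := H1 (D \ closedBall x₀ R)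

/-- `f` is the trace on `∂B_R` of `v ∈ V_R`. -/
def IsOuterTrace {D : Set Plane} {x₀ : Plane} {R : ℝ} (v : VR D x₀ R) (f : L2Circle x₀ R) :
    Prop :=
  IsTraceOn x₀ R D (fun x => -(R⁻¹ • (x - x₀))) v f

/-- The trace on `∂B_R` of `v ∈ V_R`. -/
def outerTrace {D : Set Plane} {x₀ : Plane} {R : ℝ} (v : VR D x₀ R) : L2Circle x₀ R :=
  Classical.epsilon (IsOuterTrace v)

/-! ### The interior problem and the Dirichlet-to-Neumann operator -/

/-- Weak solutions `u ∈ H¹(B_R)` of `-αΔu + u = k` in `B_R`, `u = φ` on `∂B_R`. -/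
structure IsDirichletSolution (α : ℝ) {x₀ : Plane} {R : ℝ} (k : Plane → ℝ) (φ : L2Circle x₀ R)
    (u : H1 (ball x₀ R)) : Prop where
  trace : IsInnerTrace u φ
  weak : ∀ η : H1 (ball x₀ R), IsInnerTrace η 0 →
    α * gradForm u η + massForm u.fn η = massForm k η

/-- The solution `v₀^{k,φ}` of the interior problem, for `k ∈ L²(B_R)` and `φ ∈ H^{1/2}(∂B_R)`. -/
def interiorSol (α : ℝ) {x₀ : Plane} {R : ℝ} (k : Plane → ℝ) (φ : L2Circle x₀ R) :
    H1 (ball x₀ R) :=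
  Classical.epsilon (IsDirichletSolution α k φ)

/-- An extension of `ψ ∈ H^{1/2}(∂B_R)` to `H¹(B_R)`. -/
def circleLift {x₀ : Plane} {R : ℝ} (ψ : L2Circle x₀ R) : H1 (ball x₀ R) :=
  Classical.epsilon fun Ψ => IsInnerTrace Ψ ψ

/-- The pairing of `∇u · n ∈ H^{-1/2}(∂B_R)`, `n = (x - x₀)/R`, with `ψ ∈ H^{1/2}(∂B_R)`, for
`u ∈ H¹(B_R)` with `αΔu = u - k` in `B_R`: by definition this is `∫_{B_R} (∇u · ∇Ψ + Δu Ψ) dx`,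
where `Ψ` is any extension of `ψ` to `H¹(B_R)` (the lemma below shows that the choice of `Ψ` does
not matter). -/
def normalDeriv (α : ℝ) {x₀ : Plane} {R : ℝ} (k : Plane → ℝ) (u : H1 (ball x₀ R))
    (ψ : L2Circle x₀ R) : ℝ :=
  gradForm u (circleLift ψ) + α⁻¹ * (massForm u.fn (circleLift ψ) - massForm k (circleLift ψ))

lemma gradForm_sub {U : Set Plane} (u v w : H1 U) :
    gradForm u (v - w) = gradForm u v - gradForm u w := by
  unfold gradForm
  have h : ∀ᵐ x ∂(volume.restrict U), inner ℝ (u.grad x) ((v - w).grad x)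
      = inner ℝ (u.grad x) (v.grad x) - inner ℝ (u.grad x) (w.grad x) := by
    filter_upwards [H1.grad_sub v w] with x hx
    rw [hx, inner_sub_right]
  rw [integral_congr_ae h, integral_sub]
  · exact (L2.integrable_inner (𝕜 := ℝ) (u : L2Pair U).snd (v : L2Pair U).snd)
  · exact (L2.integrable_inner (𝕜 := ℝ) (u : L2Pair U).snd (w : L2Pair U).snd)

lemma massForm_sub {U : Set Plane} {k : Plane → ℝ} (hk : MemLp k 2 (volume.restrict U))
    (v w : H1 U) : massForm k (v - w) = massForm k v - massForm k w := by
  unfold massForm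
  have h : ∀ᵐ x ∂(volume.restrict U), k x * (v - w).fn x = k x * v.fn x - k x * w.fn x := by
    filter_upwards [H1.fn_sub v w] with x hx
    rw [hx, mul_sub]
  rw [integral_congr_ae h, integral_sub]
  · exact integrable_mul_of_L2 hk v.memLp_fn
  · exact integrable_mul_of_L2 hk w.memLp_fn

lemma IsInnerTrace.sub_zero {x₀ : Plane} {R : ℝ} {u v : H1 (ball x₀ R)} {f : L2Circle x₀ R}
    (hu : IsInnerTrace u f) (hv : IsInnerTrace v f) : IsInnerTrace (u - v) 0 := by
  intro ψ hψ i
  have hint : ∀ w : H1 (ball x₀ R), Integrable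
      (fun x => w.fn x * partialDeriv i ψ x + w.grad x i * ψ x)
      (volume.restrict (ball x₀ R)) := fun w =>
    (integrable_mul_of_L2 w.memLp_fn (hψ.memLp_partialDeriv i _)).add
      (integrable_mul_of_L2 (memLp_coord w.memLp_grad i) (hψ.memLp _))
  have h : ∀ᵐ x ∂(volume.restrict (ball x₀ R)),
      (u - v).fn x * partialDeriv i ψ x + (u - v).grad x i * ψ x
        = (u.fn x * partialDeriv i ψ x + u.grad x i * ψ x)
          - (v.fn x * partialDeriv i ψ x + v.grad x i * ψ x) := by
    filter_upwards [H1.fn_sub u v, H1.grad_sub u v] with x hx hx'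
    rw [hx, hx']
    simp only [PiLp.sub_apply]
    ring
  rw [integral_congr_ae h, integral_sub (hint u) (hint v), hu ψ hψ i, hv ψ hψ i, sub_self]
  symm
  refine integral_eq_zero_of_ae ?_
  filter_upwards [Lp.coeFn_zero ℝ 2 (arcLength x₀ R)] with x hx
  rw [hx]
  simp

/-- The normal derivative of a weak solution may be computed with any extension. -/
lemma normalDeriv_eq {α : ℝ} (hα : α ≠ 0) {x₀ : Plane} {R : ℝ} {k : Plane → ℝ}
    (hk : MemLp k 2 (volume.restrict (ball x₀ R))) {φ : L2Circle x₀ R} {u : H1 (ball x₀ R)}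
    (hu : IsDirichletSolution α k φ u) {ψ : L2Circle x₀ R} {Ψ : H1 (ball x₀ R)}
    (hΨ : IsInnerTrace Ψ ψ) :
    normalDeriv α k u ψ = gradForm u Ψ + α⁻¹ * (massForm u.fn Ψ - massForm k Ψ) := by
  have hl : IsInnerTrace (circleLift ψ) ψ :=
    Classical.epsilon_spec (p := fun Ψ : H1 (ball x₀ R) => IsInnerTrace Ψ ψ) ⟨Ψ, hΨ⟩
  have h := hu.weak _ (hl.sub_zero hΨ)
  rw [gradForm_sub, massForm_sub u.memLp_fn, massForm_sub hk] at h
  unfold normalDeriv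
  field_simp
  linarith

/-- `⟨T₀ φ, ψ⟩`, where `T₀ φ = ∇v₀^{0,φ} · n` is the Dirichlet-to-Neumann operator. -/
def dtn (α : ℝ) {x₀ : Plane} {R : ℝ} (φ ψ : L2Circle x₀ R) : ℝ :=
  normalDeriv α 0 (interiorSol α 0 φ) ψ

/-- `⟨h₀, ψ⟩`, where `h₀ = -∇v₀^{k,0} · n` is the boundary datum generated by the source `k`. -/
def boundaryDatum (α : ℝ) {x₀ : Plane} {R : ℝ} (k : Plane → ℝ) (ψ : L2Circle x₀ R) : ℝ :=
  -normalDeriv α k (interiorSol α k (0 : L2Circle x₀ R)) ψ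

/-! ### The truncated exterior problem -/

/-- The bilinear form
`a₀(v,φ) = α ∫_{D∖B_R} ∇v · ∇φ dx + α ∫_{∂B_R} T₀v φ dσ + ∫_{D∖B_R} v φ dx`. -/
def a₀ (α : ℝ) {D : Set Plane} {x₀ : Plane} {R : ℝ} (v φ : VR D x₀ R) : ℝ :=
  α * gradForm v φ + α * dtn α (outerTrace v) (outerTrace φ) + massForm v.fn φ

/-- The linear form `l₀(φ) = ∫_{D∖B_R} k φ dx + α ∫_{∂B_R} h₀ φ dσ` for the source `k`. -/
def l₀ (α : ℝ) {D : Set Plane} {x₀ : Plane} {R : ℝ} (k : Plane → ℝ) (φ : VR D x₀ R) : ℝ :=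
  massForm k φ + α * boundaryDatum α k (outerTrace φ)

/-- Weak solutions `v ∈ V_R` of the truncated problem `-αΔv + v = k` in `D ∖ B_R`,
`-∂ₙv + T₀v = h₀` on `∂B_R` (with `h₀` generated by `k`), `∂ₙv = 0` on `∂D`. -/
def IsExteriorSolution (α : ℝ) {D : Set Plane} {x₀ : Plane} {R : ℝ} (k : Plane → ℝ)
    (v : VR D x₀ R) : Prop :=
  ∀ φ : VR D x₀ R, a₀ α v φ = l₀ α k φ

open Classical in
/-- The extension of `v ∈ V_R` to `D` by the interior solution `v₀^{h,φ}`, `φ = v` on `∂B_R`. -/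
def extendToDomain (α : ℝ) (h : Plane → ℝ) {D : Set Plane} {x₀ : Plane} {R : ℝ} (v : VR D x₀ R)
    (x : Plane) : ℝ :=
  if x ∈ ball x₀ R then (interiorSol α h (outerTrace v)).fn x else v.fn x

/-- The cost functional `J₀` on `V_R`: the integral over `D` of `g(x, ·)` at the extension. -/
def J₀ (α : ℝ) (h : Plane → ℝ) (g : Plane → ℝ → ℝ) {D : Set Plane} {x₀ : Plane} {R : ℝ}
    (v : VR D x₀ R) : ℝ :=
  ∫ x in D, g x (extendToDomain α h v x)

/-- `w ∈ V_R` is an adjoint state at `v₀`: `a₀(w,φ) = -DJ₀(v₀)φ` for all `φ ∈ V_R`, where `DJ₀` is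
the Fréchet derivative. -/
def IsAdjointState (α : ℝ) (h : Plane → ℝ) (g : Plane → ℝ → ℝ) {D : Set Plane} {x₀ : Plane}
    {R : ℝ} (v₀ w : VR D x₀ R) : Prop :=
  ∀ φ : VR D x₀ R, a₀ α w φ = -(fderiv ℝ (J₀ α h g) v₀ φ)

end

/-! The truncated problem is the Neumann problem on `D` with the disc eliminated. Let `u ∈ H¹(D)`
solve `-αΔu + u = k` inside the disc. Green's formula then turns the disc part of its energy against
any `φ` into the boundary terms with `T₀` and `h₀[k]`, so that the whole-domain residual at `φ`
equals `a₀ - l₀` evaluated at the restrictions (`energyL_eq_a₀`). Every function in `V_R` is a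
restriction (`exists_lift`), and an exterior solution can be glued to the interior solution with the
same trace (`exists_glue`). Hence exterior solutions are exactly the restrictions of Neumann
solutions (`isExteriorSolution_iff`). Well-posedness of the truncated problem is inherited from
Lax-Milgram on `H¹(D)`; no coercivity of `a₀` is needed.

For the adjoint state, the extension of `v₀ + φ` to `D` is `ṽ₀ + Eφ`, where `E` is the bounded
extension by the homogeneous interior problem. A quadratic Taylor remainder gives `DJ₀(v₀)φ = ∫_D
g_s(·, ṽ₀) Eφ` (`hasFDerivAt_J₀`). Symmetry of the interior energy gives `α⟨h₀[k], φ⟩ = ∫_B k Eφ`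
(`boundaryDatum_eq`), so `-DJ₀(v₀)` is precisely the load `l₀` of the source `-g_s(·, ṽ₀)`
(`l₀_eq_massForm`). The adjoint equation is therefore the truncated problem for this source. Since
`ṽ₀` is the Neumann solution on `D`, the equivalence applies once more and identifies the adjoint
state with the restriction of the adjoint on `D`.

What remains is trace theory on the circle, for an open set `D` with no boundary regularity. The
trace of `v ∈ V_R` is built as an `L²` density by Riesz representation, from Green's formula for
tangential fields and the radial projection (`exists_isOuterTrace`). It lies in `H^{1/2}` because
inversion in the circle carries a cut-off of `v` to an `H¹` function on the disc with the same trace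
(`IsOuterTrace.mem_HHalf`). -/

noncomputable section

/-! ### Hilbert space structure of `H¹` -/

/-- The Lax-Milgram theorem on a closed subspace. -/
lemma existsUnique_of_coercive {V : Type*} [NormedAddCommGroup V] [InnerProductSpace ℝ V]
    [CompleteSpace V] {A : V →L[ℝ] V →L[ℝ] ℝ} {c : ℝ} (hc : 0 < c)
    (hA : ∀ u, c * ‖u‖ * ‖u‖ ≤ A u u) (K : Submodule ℝ V) (hK : IsClosed (K : Set V))
    (l : V →L[ℝ] ℝ) : ∃! u : V, u ∈ K ∧ ∀ v ∈ K, A u v = l v := by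
  have : CompleteSpace K := hK.completeSpace_coe
  let B : K →L[ℝ] K →L[ℝ] ℝ := A.bilinearComp K.subtypeL K.subtypeL
  have hB : IsCoercive B := ⟨c, hc, fun u => hA (u : V)⟩
  let f : K := (InnerProductSpace.toDual ℝ K).symm (l.comp K.subtypeL)
  have hf : ∀ v : K, inner ℝ f v = l v := fun v => InnerProductSpace.toDual_symm_apply
  obtain ⟨u, hu⟩ := hB.continuousLinearEquivOfBilin.surjective f
  refine ⟨u, ⟨u.2, fun v hv => ?_⟩, fun u' hu' => ?_⟩
  · have := hB.continuousLinearEquivOfBilin_apply u ⟨v, hv⟩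
    rw [hu, hf] at this
    exact this.symm
  · have h1 : f = hB.continuousLinearEquivOfBilin ⟨u', hu'.1⟩ :=
      hB.unique_continuousLinearEquivOfBilin fun w => by
        rw [hf, ← hu'.2 w w.2]; rfl
    rw [← hu] at h1
    exact (congrArg Subtype.val (hB.continuousLinearEquivOfBilin.injective h1)).symm

lemma IsTestFunction.mono {W W' : Set Plane} {ψ : Plane → ℝ} (h : IsTestFunction W ψ)
    (hW : W ⊆ W') : IsTestFunction W' ψ :=
  ⟨h.smooth, h.compact, h.supp.trans hW⟩

/-- The functional `(u, G) ↦ ∫_U (u a + Gᵢ b)` on `L²(U) × L²(U)²`. -/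
def pairL {U : Set Plane} {a b : Plane → ℝ} (ha : MemLp a 2 (volume.restrict U))
    (hb : MemLp b 2 (volume.restrict U)) (i : Fin 2) : L2Pair U →L[ℝ] ℝ :=
  (innerSL ℝ (ha.toLp a)).comp (WithLp.fstL 2 ℝ _ _) +
    (innerSL ℝ (hb.toLp b)).comp
      (((EuclideanSpace.proj (𝕜 := ℝ) i : Plane →L[ℝ] ℝ).compLpL 2 (volume.restrict U)).comp
        (WithLp.sndL 2 ℝ _ _))

lemma integral_mul_eq_inner {μ : Measure Plane} {a : Plane → ℝ} (ha : MemLp a 2 μ)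
    (f : Lp ℝ 2 μ) : inner ℝ (ha.toLp a) f = ∫ x, f x * a x ∂μ := by
  rw [L2.inner_def]
  refine integral_congr_ae ?_
  filter_upwards [ha.coeFn_toLp] with x hx
  simp [hx]

lemma pairL_apply {U : Set Plane} {a b : Plane → ℝ} (ha : MemLp a 2 (volume.restrict U))
    (hb : MemLp b 2 (volume.restrict U)) (i : Fin 2) (p : L2Pair U) :
    pairL ha hb i p = ∫ x in U, (p.fst x * a x + p.snd x i * b x) := by
  have h2 := ContinuousLinearMap.coeFn_compLpL (p := 2) (μ := volume.restrict U)
    (EuclideanSpace.proj (𝕜 := ℝ) i : Plane →L[ℝ] ℝ) p.snd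
  have e : pairL ha hb i p = inner ℝ (ha.toLp a) p.fst + inner ℝ (hb.toLp b)
    ((EuclideanSpace.proj (𝕜 := ℝ) i : Plane →L[ℝ] ℝ).compLpL 2 (volume.restrict U) p.snd) := rfl
  rw [e, integral_mul_eq_inner, integral_mul_eq_inner, integral_add]
  · congr 1
    refine integral_congr_ae ?_
    filter_upwards [h2] with x hx
    rw [hx]; rfl
  · exact integrable_mul_of_L2 (Lp.memLp _) ha
  · exact integrable_mul_of_L2 (memLp_coord (Lp.memLp _) i) hb

/-- The functional `(u, G) ↦ ∫_U (u ∂ᵢψ + Gᵢ ψ)`. -/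
def greenL (U : Set Plane) {ψ : Plane → ℝ} {W : Set Plane} (hψ : IsTestFunction W ψ)
    (i : Fin 2) : L2Pair U →L[ℝ] ℝ :=
  pairL (hψ.memLp_partialDeriv i (volume.restrict U)) (hψ.memLp (volume.restrict U)) i

lemma greenL_apply {U : Set Plane} {ψ : Plane → ℝ} {W : Set Plane} (hψ : IsTestFunction W ψ)
    (i : Fin 2) (u : H1 U) :
    greenL U hψ i (u : L2Pair U)
      = ∫ x in U, (u.fn x * partialDeriv i ψ x + u.grad x i * ψ x) :=
  pairL_apply _ _ _ _

lemma integral_green_split {U : Set Plane} {ψ : Plane → ℝ} {W : Set Plane}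
    (hψ : IsTestFunction W ψ) (i : Fin 2) {u : Plane → ℝ} {G : Plane → Plane}
    (hu : MemLp u 2 (volume.restrict U)) (hG : MemLp G 2 (volume.restrict U)) :
    ∫ x in U, (u x * partialDeriv i ψ x + G x i * ψ x)
      = (∫ x in U, u x * partialDeriv i ψ x) + ∫ x in U, G x i * ψ x :=
  integral_add (integrable_mul_of_L2 hu (hψ.memLp_partialDeriv i _))
    (integrable_mul_of_L2 (memLp_coord hG i) (hψ.memLp _))

/-- With everything under one integral, the condition says that the continuous functionals `greenL`
vanish on the pair. Closedness of `H¹(U)` and of `H¹₀(B_R)` is read off from this form. -/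
lemma hasWeakGradient_iff {U : Set Plane} {u : Plane → ℝ} {G : Plane → Plane}
    (hu : MemLp u 2 (volume.restrict U)) (hG : MemLp G 2 (volume.restrict U)) :
    HasWeakGradient U u G ↔ ∀ ψ : Plane → ℝ, IsTestFunction U ψ → ∀ i : Fin 2,
      ∫ x in U, (u x * partialDeriv i ψ x + G x i * ψ x) = 0 := by
  refine forall_congr' fun ψ => forall_congr' fun hψ => forall_congr' fun i => ?_
  rw [integral_green_split hψ i hu hG, eq_neg_iff_add_eq_zero]

lemma isClosed_H1Submodule (U : Set Plane) : IsClosed (H1Submodule U : Set (L2Pair U)) := by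
  have : (H1Submodule U : Set (L2Pair U)) = ⋂ (ψ : Plane → ℝ) (hψ : IsTestFunction U ψ)
      (i : Fin 2), {p | greenL U hψ i p = 0} := by
    ext p
    simp only [mem_iInter, mem_ofPred_eq]
    refine (hasWeakGradient_iff (Lp.memLp p.fst) (Lp.memLp p.snd)).trans ?_
    refine forall_congr' fun ψ => forall_congr' fun hψ => forall_congr' fun i => ?_
    rw [greenL, pairL_apply]
  rw [this]
  exact isClosed_iInter fun ψ => isClosed_iInter fun hψ => isClosed_iInter fun i =>
    isClosed_eq (ContinuousLinearMap.continuous _) continuous_const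

instance H1.completeSpace (U : Set Plane) : CompleteSpace (H1 U) :=
  (isClosed_H1Submodule U).completeSpace_coe

/-- The function of an element of `H¹(U)`, as a continuous linear map to `L²(U)`. -/
def H1.fnL (U : Set Plane) : H1 U →L[ℝ] Lp ℝ 2 (volume.restrict U) :=
  (WithLp.fstL 2 ℝ _ _).comp (H1Submodule U).subtypeL

/-- The gradient as a continuous linear map from `H¹(U)` to `L²(U)²`. -/
def H1.gradL (U : Set Plane) : H1 U →L[ℝ] Lp Plane 2 (volume.restrict U) :=
  (WithLp.sndL 2 ℝ _ _).comp (H1Submodule U).subtypeL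

lemma H1.coeFn_fnL {U : Set Plane} (u : H1 U) : (H1.fnL U u : Plane → ℝ) = u.fn := rfl

lemma gradForm_eq_inner {U : Set Plane} (u v : H1 U) :
    gradForm u v = inner ℝ (H1.gradL U u) (H1.gradL U v) := by
  rw [L2.inner_def]; rfl

lemma massForm_eq_inner {U : Set Plane} {k : Plane → ℝ} (hk : MemLp k 2 (volume.restrict U))
    (v : H1 U) : massForm k v = inner ℝ (hk.toLp k) (H1.fnL U v) := by
  rw [integral_mul_eq_inner hk]
  simp only [massForm, H1.coeFn_fnL, mul_comm]

lemma massForm_fn_eq_inner {U : Set Plane} (u v : H1 U) :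
    massForm u.fn v = inner ℝ (H1.fnL U u) (H1.fnL U v) := by
  rw [massForm_eq_inner u.memLp_fn]
  congr 1
  exact Lp.toLp_coeFn _ _

lemma massForm_congr {U : Set Plane} {k k' : Plane → ℝ} (h : k =ᵐ[volume.restrict U] k')
    (v : H1 U) : massForm k v = massForm k' v :=
  integral_congr_ae (by filter_upwards [h] with x hx; rw [hx])

lemma massForm_zero {U : Set Plane} (v : H1 U) : massForm 0 v = 0 := by
  simp [massForm]

lemma H1.norm_sq {U : Set Plane} (u : H1 U) :
    ‖u‖ ^ 2 = massForm u.fn u + gradForm u u := by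
  rw [massForm_fn_eq_inner, gradForm_eq_inner, ← real_inner_self_eq_norm_sq]
  exact WithLp.prod_inner_apply (u : L2Pair U) (u : L2Pair U)

/-- The functional `v ↦ ∫_U k v`. -/
def massL {U : Set Plane} {k : Plane → ℝ} (hk : MemLp k 2 (volume.restrict U)) : H1 U →L[ℝ] ℝ :=
  (innerSL ℝ (hk.toLp k)).comp (H1.fnL U)

lemma massL_apply {U : Set Plane} {k : Plane → ℝ} (hk : MemLp k 2 (volume.restrict U))
    (v : H1 U) : massL hk v = massForm k v := (massForm_eq_inner hk v).symm

/-- The energy form `α ∫ ∇u · ∇v + ∫ u v`. -/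
def energyL (α : ℝ) (U : Set Plane) : H1 U →L[ℝ] H1 U →L[ℝ] ℝ :=
  α • (innerSL ℝ).bilinearComp (H1.gradL U) (H1.gradL U) +
    (innerSL ℝ).bilinearComp (H1.fnL U) (H1.fnL U)

lemma energyL_apply (α : ℝ) {U : Set Plane} (u v : H1 U) :
    energyL α U u v = α * gradForm u v + massForm u.fn v := by
  rw [gradForm_eq_inner, massForm_fn_eq_inner]; rfl

lemma energyL_symm (α : ℝ) {U : Set Plane} (u v : H1 U) :
    energyL α U u v = energyL α U v u := by
  rw [energyL_apply, energyL_apply, gradForm_eq_inner, gradForm_eq_inner, massForm_fn_eq_inner,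
    massForm_fn_eq_inner, real_inner_comm, real_inner_comm (H1.fnL U u)]

lemma energyL_add_left (α : ℝ) {U : Set Plane} (u v w : H1 U) :
    energyL α U (u + v) w = energyL α U u w + energyL α U v w :=
  (energyL α U).map_add₂ u v w

lemma energyL_sub_left (α : ℝ) {U : Set Plane} (u v w : H1 U) :
    energyL α U (u - v) w = energyL α U u w - energyL α U v w :=
  (energyL α U).map_sub₂ u v w

attribute [irreducible] energyL

lemma gradForm_self_nonneg {U : Set Plane} (u : H1 U) : 0 ≤ gradForm u u := by
  rw [gradForm_eq_inner]; exact real_inner_self_nonneg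

lemma massForm_self_nonneg {U : Set Plane} (u : H1 U) : 0 ≤ massForm u.fn u := by
  rw [massForm_fn_eq_inner]; exact real_inner_self_nonneg

lemma energyL_coercive (α : ℝ) {U : Set Plane} (u : H1 U) :
    min α 1 * ‖u‖ * ‖u‖ ≤ energyL α U u u := by
  rw [mul_assoc, ← sq, H1.norm_sq, energyL_apply, mul_add, add_comm]
  have h1 := mul_le_mul_of_nonneg_right (min_le_left α 1) (gradForm_self_nonneg u)
  have h2 := mul_le_mul_of_nonneg_right (min_le_right α 1) (massForm_self_nonneg u)
  linarith

/-- The energy form is uniquely solvable on every closed subspace of `H¹(U)`. -/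
lemma existsUnique_energyL {α : ℝ} (hα : 0 < α) {U : Set Plane} (K : Submodule ℝ (H1 U))
    (hK : IsClosed (K : Set (H1 U))) (l : H1 U →L[ℝ] ℝ) :
    ∃! u : H1 U, u ∈ K ∧ ∀ v ∈ K, energyL α U u v = l v :=
  existsUnique_of_coercive (lt_min hα one_pos) (fun u => energyL_coercive α u) K hK l

lemma isNeumannSolution_iff {α : ℝ} {D : Set Plane} {k : Plane → ℝ}
    (hk : MemLp k 2 (volume.restrict D)) (u : H1 D) :
    IsNeumannSolution α D k u ↔ ∀ φ, energyL α D u φ = massL hk φ := by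
  simp only [IsNeumannSolution, energyL_apply, massL_apply]

lemma existsUnique_isNeumannSolution {α : ℝ} (hα : 0 < α) {D : Set Plane} {k : Plane → ℝ}
    (hk : MemLp k 2 (volume.restrict D)) : ∃! u : H1 D, IsNeumannSolution α D k u := by
  have := existsUnique_energyL hα (U := D) ⊤ isClosed_univ (massL hk)
  simpa [isNeumannSolution_iff hk] using this

lemma IsNeumannSolution.congr {α : ℝ} {D : Set Plane} {k k' : Plane → ℝ} {u : H1 D}
    (h : k =ᵐ[volume.restrict D] k') (hu : IsNeumannSolution α D k u) :
    IsNeumannSolution α D k' u := fun φ => by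
  rw [hu φ, massForm_congr h]

/-! ### The interior problem -/

section interior

variable {x₀ : Plane} {R : ℝ}

lemma isInnerTrace_iff_greenL {u : H1 (ball x₀ R)} {f : L2Circle x₀ R} :
    IsInnerTrace u f ↔ ∀ ψ (hψ : IsTestFunction univ ψ) (i : Fin 2),
      greenL (ball x₀ R) hψ i (u : L2Pair (ball x₀ R))
        = ∫ x, f x * ψ x * (R⁻¹ • (x - x₀)) i ∂(arcLength x₀ R) := by
  simp only [greenL_apply]; rfl

lemma isInnerTrace_zero_iff {u : H1 (ball x₀ R)} :
    IsInnerTrace u 0 ↔ ∀ ψ (hψ : IsTestFunction univ ψ) (i : Fin 2),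
      greenL (ball x₀ R) hψ i (u : L2Pair (ball x₀ R)) = 0 := by
  rw [isInnerTrace_iff_greenL]
  refine forall_congr' fun ψ => forall_congr' fun hψ => forall_congr' fun i => ?_
  have : ∫ x, (0 : L2Circle x₀ R) x * ψ x * (R⁻¹ • (x - x₀)) i ∂(arcLength x₀ R) = 0 := by
    refine integral_eq_zero_of_ae ?_
    filter_upwards [Lp.coeFn_zero ℝ 2 (arcLength x₀ R)] with x hx
    rw [hx]
    simp
  rw [this]

/-- `H¹₀(B_R)`, the functions with zero trace. -/
def H10 (x₀ : Plane) (R : ℝ) : Submodule ℝ (H1 (ball x₀ R)) where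
  carrier := {u | IsInnerTrace u 0}
  zero_mem' := isInnerTrace_zero_iff.2 fun ψ hψ i => by simp
  add_mem' := fun {u v} hu hv => isInnerTrace_zero_iff.2 fun ψ hψ i => by
    have h1 := isInnerTrace_zero_iff.1 hu ψ hψ i
    have h2 := isInnerTrace_zero_iff.1 hv ψ hψ i
    rw [Submodule.coe_add, map_add, h1, h2, add_zero]
  smul_mem' := fun c u hu => isInnerTrace_zero_iff.2 fun ψ hψ i => by
    have h1 := isInnerTrace_zero_iff.1 hu ψ hψ i
    rw [Submodule.coe_smul, map_smul, h1, smul_zero]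

lemma mem_H10 {u : H1 (ball x₀ R)} : u ∈ H10 x₀ R ↔ IsInnerTrace u 0 := Iff.rfl

lemma isClosed_H10 : IsClosed (H10 x₀ R : Set (H1 (ball x₀ R))) := by
  have : (H10 x₀ R : Set (H1 (ball x₀ R))) = ⋂ (ψ : Plane → ℝ) (hψ : IsTestFunction univ ψ)
      (i : Fin 2), {u : H1 (ball x₀ R) | greenL (ball x₀ R) hψ i (u : L2Pair (ball x₀ R)) = 0} := by
    ext p
    simp only [mem_iInter, mem_ofPred_eq]
    exact isInnerTrace_zero_iff
  rw [this]
  exact isClosed_iInter fun ψ => isClosed_iInter fun hψ => isClosed_iInter fun i =>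
    isClosed_eq ((ContinuousLinearMap.continuous _).comp continuous_subtype_val) continuous_const

lemma IsInnerTrace.add_zero {u v : H1 (ball x₀ R)} {f : L2Circle x₀ R} (hu : IsInnerTrace u f)
    (hv : IsInnerTrace v 0) : IsInnerTrace (u + v) f := by
  rw [isInnerTrace_iff_greenL] at *
  intro ψ hψ i
  rw [Submodule.coe_add, map_add, hu ψ hψ i, isInnerTrace_zero_iff.1
    (isInnerTrace_iff_greenL.2 hv) ψ hψ i, _root_.add_zero]

lemma IsDirichletSolution.energy {α : ℝ} {k : Plane → ℝ} {φ : L2Circle x₀ R}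
    {u : H1 (ball x₀ R)} (hu : IsDirichletSolution α k φ u) {η : H1 (ball x₀ R)}
    (hη : IsInnerTrace η 0) : energyL α _ u η = massForm k η := by
  rw [energyL_apply, hu.weak η hη]

/-- Membership in `HHalf` provides a lift `w` of the boundary value. The correction `u - w` has zero
trace and is found by Lax-Milgram on `H10`. -/
lemma existsUnique_isDirichletSolution {α : ℝ} (hα : 0 < α) {k : Plane → ℝ}
    (hk : MemLp k 2 (volume.restrict (ball x₀ R))) {φ : L2Circle x₀ R} (hφ : φ ∈ HHalf x₀ R) :
    ∃! u : H1 (ball x₀ R), IsDirichletSolution α k φ u := by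
  obtain ⟨w, hw⟩ := hφ
  obtain ⟨l, hl⟩ : ∃ l : H1 (ball x₀ R) →L[ℝ] ℝ,
      ∀ η, l η = massForm k η - energyL α (ball x₀ R) w η :=
    ⟨massL hk - energyL α (ball x₀ R) w, fun η => by rw [← massL_apply hk]; rfl⟩
  obtain ⟨z, ⟨hz, hzs⟩, huniq⟩ := existsUnique_energyL hα (H10 x₀ R) isClosed_H10 l
  refine ⟨w + z, ⟨hw.add_zero hz, fun η hη => ?_⟩, fun u hu => ?_⟩
  · have := hzs η hη
    rw [← energyL_apply, energyL_add_left, this, hl]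
    ring
  · have h1 : ∀ η ∈ H10 x₀ R, energyL α (ball x₀ R) (u - w) η = l η := by
      intro η hη
      have h4 := hu.energy (mem_H10.1 hη)
      rw [energyL_sub_left, hl]
      linarith
    have h2 : u - w ∈ H10 x₀ R := mem_H10.2 (hu.trace.sub_zero hw)
    have h3 : u - w = z := huniq (u - w) ⟨h2, h1⟩
    rw [← h3, add_sub_cancel]

end interior

/-! ### Test functions -/

/-- Needed for factors that are singular at the centre `x₀`, namely the radial projection and the
derivative of the inversion; the cutoff `ρ` keeps away from the singularity. -/
lemma IsTestFunction.mul_contDiffOn {W : Set Plane} (hW : IsOpen W) {ρ F : Plane → ℝ}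
    (hρ : IsTestFunction W ρ) (hF : ContDiffOn ℝ ∞ F W) :
    IsTestFunction W (fun x => ρ x * F x) where
  smooth := contDiff_iff_contDiffAt.2 fun x => by
    by_cases hx : x ∈ tsupport ρ
    · exact hρ.smooth.contDiffAt.mul (hF.contDiffAt (hW.mem_nhds (hρ.supp hx)))
    · refine (contDiffAt_const (c := (0 : ℝ))).congr_of_eventuallyEq ?_
      filter_upwards [(isClosed_tsupport ρ).isOpen_compl.mem_nhds hx] with y hy
      rw [image_eq_zero_of_notMem_tsupport hy, zero_mul]
  compact := hρ.compact.mul_right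
  supp := (tsupport_mul_subset_left).trans hρ.supp

lemma IsTestFunction.mul_contDiff {W : Set Plane} {ρ F : Plane → ℝ}
    (hρ : IsTestFunction W ρ) (hF : ContDiff ℝ ∞ F) : IsTestFunction W (fun x => ρ x * F x) where
  smooth := hρ.smooth.mul hF
  compact := hρ.compact.mul_right
  supp := (tsupport_mul_subset_left).trans hρ.supp

lemma IsTestFunction.sub {W : Set Plane} {ρ F : Plane → ℝ}
    (hρ : IsTestFunction W ρ) (hF : IsTestFunction W F) :
    IsTestFunction W (fun x => ρ x - F x) where
  smooth := hρ.smooth.sub hF.smooth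
  compact := hρ.compact.sub hF.compact
  supp := (tsupport_sub ρ F).trans (union_subset hρ.supp hF.supp)

lemma IsTestFunction.const_mul {W : Set Plane} {ψ : Plane → ℝ} (hψ : IsTestFunction W ψ) (c : ℝ) :
    IsTestFunction W (fun x => c * ψ x) where
  smooth := contDiff_const.mul hψ.smooth
  compact := hψ.compact.mul_left
  supp := (tsupport_mul_subset_right).trans hψ.supp

lemma exists_isTestFunction_eqOn_one {K W : Set Plane} (hK : IsCompact K) (hW : IsOpen W)
    (hKW : K ⊆ W) : ∃ ρ : Plane → ℝ, IsTestFunction W ρ ∧ ∀ x ∈ K, ρ x = 1 := by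
  obtain ⟨L, hL, hKL, hLW⟩ := exists_compact_between hK hW hKW
  obtain ⟨f, hf1, hf0, -⟩ := exists_contMDiffMap_one_nhds_of_subset_interior
    (modelWithCornersSelf ℝ Plane) (n := (⊤ : ℕ∞)) hK.isClosed hKL
  have hsupp : tsupport f ⊆ L := closure_minimal (fun x hx => by
    by_contra h
    exact hx (hf0 x h)) hL.isClosed
  exact ⟨f, ⟨f.contMDiff.contDiff, HasCompactSupport.of_support_subset_isCompact hL
    ((subset_tsupport _).trans hsupp), hsupp.trans hLW⟩, fun x hx => hf1.self_of_nhdsSet x hx⟩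

lemma IsTestFunction.differentiable {W : Set Plane} {ψ : Plane → ℝ} (h : IsTestFunction W ψ) :
    Differentiable ℝ ψ := h.smooth.differentiable (by simp)

lemma IsTestFunction.eq_zero {W : Set Plane} {ψ : Plane → ℝ} (h : IsTestFunction W ψ) {x : Plane}
    (hx : x ∉ W) : ψ x = 0 := image_eq_zero_of_notMem_tsupport fun h' => hx (h.supp h')

lemma partialDeriv_eq_zero {ψ : Plane → ℝ} {x : Plane} (hx : x ∉ tsupport ψ) (i : Fin 2) :
    partialDeriv i ψ x = 0 := by
  have h0 : fderiv ℝ ψ x = 0 := image_eq_zero_of_notMem_tsupport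
    fun h => hx (tsupport_fderiv_subset ℝ h)
  simp [partialDeriv, h0]

lemma IsTestFunction.partialDeriv_eq_zero {W : Set Plane} {ψ : Plane → ℝ}
    (h : IsTestFunction W ψ) {x : Plane} (hx : x ∉ W) (i : Fin 2) : partialDeriv i ψ x = 0 :=
  _root_.partialDeriv_eq_zero (fun h' => hx (h.supp h')) i

lemma partialDeriv_mul {f g : Plane → ℝ} {x : Plane} (hf : DifferentiableAt ℝ f x)
    (hg : DifferentiableAt ℝ g x) (i : Fin 2) :
    partialDeriv i (fun y => f y * g y) x = f x * partialDeriv i g x + g x * partialDeriv i f x := by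
  simp only [partialDeriv]
  rw [fderiv_fun_mul hf hg]
  simp

lemma partialDeriv_sub {f g : Plane → ℝ} {x : Plane} (hf : DifferentiableAt ℝ f x)
    (hg : DifferentiableAt ℝ g x) (i : Fin 2) :
    partialDeriv i (fun y => f y - g y) x = partialDeriv i f x - partialDeriv i g x := by
  simp only [partialDeriv]
  rw [fderiv_fun_sub hf hg]
  simp

lemma partialDeriv_const_mul {f : Plane → ℝ} {x : Plane} (hf : DifferentiableAt ℝ f x) (c : ℝ)
    (i : Fin 2) : partialDeriv i (fun y => c * f y) x = c * partialDeriv i f x := by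
  simp only [partialDeriv]
  rw [fderiv_const_mul hf]
  simp

lemma clm_apply_eq_sum {E : Type*} [AddCommMonoid E] [Module ℝ E] [TopologicalSpace E]
    (L : Plane →L[ℝ] E) (w : Plane) :
    L w = ∑ j, w j • L (EuclideanSpace.single j 1) := by
  conv_lhs => rw [← (EuclideanSpace.basisFun (Fin 2) ℝ).sum_repr w]
  simp

lemma fderiv_apply_eq_sum (f : Plane → ℝ) (x w : Plane) :
    fderiv ℝ f x w = ∑ j, w j * partialDeriv j f x := clm_apply_eq_sum _ w

lemma partialDeriv_coord_sub (x₀ x : Plane) (i j : Fin 2) :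
    partialDeriv i (fun y : Plane => (y - x₀) j) x = if i = j then 1 else 0 := by
  have h : HasFDerivAt (fun y : Plane => (y - x₀) j)
      (EuclideanSpace.proj (𝕜 := ℝ) j : Plane →L[ℝ] ℝ) x :=
    (EuclideanSpace.proj (𝕜 := ℝ) j : Plane →L[ℝ] ℝ).hasFDerivAt.comp x
      ((hasFDerivAt_id x).sub_const x₀)
  simp only [partialDeriv, h.fderiv]
  simp [eq_comm]

lemma contDiff_coord_sub (x₀ : Plane) (j : Fin 2) :
    ContDiff ℝ ∞ (fun y : Plane => (y - x₀) j) :=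
  (EuclideanSpace.proj (𝕜 := ℝ) j : Plane →L[ℝ] ℝ).contDiff.comp (contDiff_id.sub contDiff_const)

lemma sum_sq_eq_norm_sq (w : Plane) : ∑ j, w j * w j = ‖w‖ ^ 2 := by
  rw [EuclideanSpace.real_norm_sq_eq]
  simp [sq]

/-! ### Arc length -/

section arc

variable (x₀ : Plane) (R : ℝ)

instance arcLength.isFiniteMeasure : IsFiniteMeasure (arcLength x₀ R) := by
  constructor
  rw [arcLength, Measure.smul_apply, smul_eq_mul]
  exact ENNReal.mul_lt_top ENNReal.ofReal_lt_top (measure_lt_top _ _)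

lemma measurable_circleMap' :
    Measurable fun θ : sphere (0 : Plane) 1 => x₀ + R • (θ : Plane) := by
  fun_prop

variable {x₀ R}

lemma ae_arcLength_mem_sphere (hR : 0 < R) : ∀ᵐ x ∂(arcLength x₀ R), x ∈ sphere x₀ R := by
  refine Measure.ae_smul_measure ?_ _
  refine (ae_map_iff (p := fun x => x ∈ sphere x₀ R) (measurable_circleMap' x₀ R).aemeasurable
    isClosed_sphere.measurableSet).2 ?_
  refine Filter.Eventually.of_forall fun θ => ?_
  have : ‖(θ : Plane)‖ = 1 := by simp
  simp [norm_smul, this, abs_of_pos hR]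

/-- The radial projection onto the circle `∂B_R`. -/
def radialProj (x₀ : Plane) (R : ℝ) (x : Plane) : Plane := x₀ + (R / ‖x - x₀‖) • (x - x₀)

lemma measurable_radialProj : Measurable (radialProj x₀ R) := by
  unfold radialProj
  fun_prop

lemma radialProj_of_mem_sphere (hR : 0 < R) {x : Plane} (hx : x ∈ sphere x₀ R) :
    radialProj x₀ R x = x := by
  rw [mem_sphere, dist_eq_norm] at hx
  rw [radialProj, hx, div_self hR.ne', one_smul, add_sub_cancel]

lemma radialProj_mem_sphere (hR : 0 < R) {x : Plane} (hx : x ≠ x₀) :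
    radialProj x₀ R x ∈ sphere x₀ R := by
  have : 0 < ‖x - x₀‖ := norm_pos_iff.2 (sub_ne_zero.2 hx)
  rw [mem_sphere, dist_eq_norm, radialProj, add_sub_cancel_left, norm_smul, Real.norm_eq_abs,
    abs_of_pos (by positivity), div_mul_cancel₀ _ this.ne']

lemma contDiffAt_radialProj {x : Plane} (hx : x ≠ x₀) : ContDiffAt ℝ ∞ (radialProj x₀ R) x := by
  have h : ContDiffAt ℝ ∞ (fun y : Plane => y - x₀) x := contDiffAt_id.sub contDiffAt_const
  exact contDiffAt_const.add ((contDiffAt_const.div (h.norm ℝ (sub_ne_zero.2 hx))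
    (norm_ne_zero_iff.2 (sub_ne_zero.2 hx))).smul h)

open scoped Pointwise in
/-- The radial projection of Lebesgue measure is dominated by arc length. -/
lemma map_radialProj_le (hR : 0 < R) {R' : ℝ} (hR' : 0 < R') :
    (volume.restrict (ball x₀ R' \ {x₀})).map (radialProj x₀ R)
      ≤ ENNReal.ofReal (R' ^ 2 / R) • arcLength x₀ R := by
  refine Measure.le_iff.2 fun T hT => ?_
  set s : Set (sphere (0 : Plane) 1) := (fun θ => x₀ + R • (θ : Plane)) ⁻¹' T with hs
  have hsm : MeasurableSet s := measurable_circleMap' x₀ R hT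
  -- Points of the punctured disc that project into `T` lie in the sector over `s`, scaled by `R'`.
  have h1 : radialProj x₀ R ⁻¹' T ∩ (ball x₀ R' \ {x₀})
      ⊆ (x₀ + ·) '' (R' • (Ioo (0 : ℝ) 1 • ((↑) '' s : Set Plane))) := by
    rintro x ⟨hxT, hxb, hx0⟩
    have hpos : 0 < ‖x - x₀‖ := norm_pos_iff.2 (sub_ne_zero.2 hx0)
    rw [mem_ball, dist_eq_norm] at hxb
    refine ⟨x - x₀, ?_, by simp⟩
    refine ⟨(‖x - x₀‖ / R') • (‖x - x₀‖⁻¹ • (x - x₀)), ?_, ?_⟩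
    · refine smul_mem_smul ⟨by positivity, (div_lt_one hR').2 hxb⟩ ?_
      refine ⟨⟨‖x - x₀‖⁻¹ • (x - x₀), by simp [norm_smul, hpos.ne']⟩, ?_, rfl⟩
      rw [hs, mem_preimage]
      simpa [radialProj, smul_smul, div_eq_mul_inv] using hxT
    · simp only [smul_smul]
      rw [show R' * (‖x - x₀‖ / R' * ‖x - x₀‖⁻¹) = 1 by field_simp, one_smul]
  rw [Measure.map_apply measurable_radialProj hT,
    Measure.restrict_apply (measurable_radialProj hT)]
  refine (measure_mono h1).trans ?_
  rw [image_add_left, measure_preimage_add, Measure.addHaar_smul, Measure.smul_apply, arcLength,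
    Measure.smul_apply, Measure.map_apply (measurable_circleMap' x₀ R) hT, ← hs,
    Measure.toSphere_apply' _ hsm, smul_eq_mul, smul_eq_mul, ← mul_assoc,
    ← ENNReal.ofReal_mul (by positivity), div_mul_cancel₀ _ hR.ne']
  simp only [finrank_euclideanSpace, Fintype.card_fin, abs_pow, sq_abs, Nat.cast_ofNat]
  -- In dimension two `toSphere` is twice the area of the unit sector; this factor of two is given
  -- away.
  gcongr
  exact le_mul_of_one_le_left zero_le (by norm_num)

end arc

/-- A square integrable weight followed by a substitution defines an `L²` density. -/
lemma exists_density_of_map_le {μ ν : Measure Plane} {P : Plane → Plane} (hP : Measurable P)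
    {c : ℝ≥0∞} (hc : c ≠ ⊤) (hle : μ.map P ≤ c • ν) {q : Plane → ℝ} (hq : MemLp q 2 μ) :
    ∃ f : Lp ℝ 2 ν, ∀ φ : Plane → ℝ, MemLp φ 2 ν → ∫ x, q x * φ (P x) ∂μ = ∫ x, f x * φ x ∂ν := by
  have hmem : ∀ {φ : Plane → ℝ}, MemLp φ 2 ν → MemLp (φ ∘ P) 2 μ := fun hφ =>
    (hφ.of_measure_le_smul hc hle).comp_of_map hP.aemeasurable
  have hqmp : Measure.QuasiMeasurePreserving P μ ν :=
    ⟨hP, (Measure.absolutelyContinuous_of_le hle).trans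
      (Measure.AbsolutelyContinuous.rfl.smul_left c)⟩
  set C : ℝ≥0∞ := c ^ (1 / (2 : ℝ≥0∞)).toReal with hC
  have hCtop : C ≠ ⊤ := ENNReal.rpow_ne_top_of_nonneg (by simp) hc
  have hint : ∀ {φ : Plane → ℝ} (hφ : MemLp φ 2 ν), ∫ x, q x * φ (P x) ∂μ
      = inner ℝ ((hmem hφ).toLp (φ ∘ P)) (hq.toLp q) := by
    intro φ hφ
    rw [integral_mul_eq_inner]
    refine integral_congr_ae ?_
    filter_upwards [hq.coeFn_toLp] with x hx
    rw [hx]; rfl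
  have hbound : ∀ {φ : Plane → ℝ} (hφ : MemLp φ 2 ν),
      |∫ x, q x * φ (P x) ∂μ| ≤ C.toReal * ‖hq.toLp q‖ * ‖hφ.toLp φ‖ := by
    intro φ hφ
    rw [hint hφ]
    refine (abs_real_inner_le_norm _ _).trans ?_
    have h1 : ‖(hmem hφ).toLp (φ ∘ P)‖ ≤ C.toReal * ‖hφ.toLp φ‖ := by
      rw [Lp.norm_toLp, Lp.norm_toLp, ← ENNReal.toReal_mul]
      refine ENNReal.toReal_mono (ENNReal.mul_ne_top hCtop hφ.2.ne) ?_
      rw [← eLpNorm_map_measure (hφ.of_measure_le_smul hc hle).1 hP.aemeasurable]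
      exact eLpNorm_le_of_measure_le_smul hle
    nlinarith [norm_nonneg (hq.toLp q)]
  -- The functional is well defined on classes because `P` pulls null sets back to null sets, and
  -- bounded by Cauchy-Schwarz and the domination `hle`. The density is its Riesz representative.
  let Λ : Lp ℝ 2 ν →ₗ[ℝ] ℝ :=
    { toFun := fun φ => ∫ x, q x * φ (P x) ∂μ
      map_add' := fun φ χ => by
        refine Eq.trans (integral_congr_ae ?_)
          (integral_add (integrable_mul_of_L2 hq (hmem (Lp.memLp φ)))
            (integrable_mul_of_L2 hq (hmem (Lp.memLp χ))))
        filter_upwards [hqmp.ae (Lp.coeFn_add φ χ)] with x hx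
        rw [hx, Pi.add_apply]
        exact mul_add _ _ _
      map_smul' := fun a φ => by
        simp only [RingHom.id_apply, smul_eq_mul]
        rw [← integral_const_mul]
        refine integral_congr_ae ?_
        filter_upwards [hqmp.ae (Lp.coeFn_smul a φ)] with x hx
        rw [hx, Pi.smul_apply, smul_eq_mul]
        ring }
  let Λ' : Lp ℝ 2 ν →L[ℝ] ℝ := Λ.mkContinuous (C.toReal * ‖hq.toLp q‖) fun φ => by
    have := hbound (Lp.memLp φ)
    rwa [Lp.toLp_coeFn] at this
  refine ⟨(InnerProductSpace.toDual ℝ _).symm Λ', fun φ hφ => ?_⟩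
  have h1 : inner ℝ ((InnerProductSpace.toDual ℝ _).symm Λ') (hφ.toLp φ)
      = ∫ x, q x * (hφ.toLp φ : Plane → ℝ) (P x) ∂μ := InnerProductSpace.toDual_symm_apply
  rw [real_inner_comm, integral_mul_eq_inner] at h1
  rw [h1]
  refine integral_congr_ae ?_
  filter_upwards [hqmp.ae hφ.coeFn_toLp] with x hx
  rw [hx]

/-! ### The trace on the circle of functions in `V_R` -/

lemma deriv_smoothTransition_eq_zero {t : ℝ} (ht : t < 0 ∨ 1 < t) :
    deriv Real.smoothTransition t = 0 := by
  rcases ht with ht | ht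
  · have h : Real.smoothTransition =ᶠ[nhds t] fun _ => 0 := by
      filter_upwards [Iio_mem_nhds ht] with y hy
      exact Real.smoothTransition.zero_of_nonpos (le_of_lt hy)
    rw [h.deriv_eq, deriv_const]
  · have h : Real.smoothTransition =ᶠ[nhds t] fun _ => 1 := by
      filter_upwards [Ioi_mem_nhds ht] with y hy
      exact Real.smoothTransition.one_of_one_le (le_of_lt hy)
    rw [h.deriv_eq, deriv_const]

/-- Used with `t = k(|x - x₀|² - R²)`: the derivative of the cutoff grows like `k`, but its product
with the distance to the circle stays bounded uniformly in `k`. -/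
lemma exists_bound_deriv_smoothTransition :
    ∃ C : ℝ, ∀ t, |deriv Real.smoothTransition (t - 1) * t| ≤ C := by
  have hc : Continuous fun t : ℝ => deriv Real.smoothTransition (t - 1) * t :=
    (((Real.smoothTransition.contDiff (n := 1)).continuous_deriv le_rfl).comp
      (continuous_id.sub continuous_const)).mul continuous_id
  obtain ⟨C, hC⟩ := (isCompact_Icc (a := (1 : ℝ)) (b := 2)).exists_bound_of_continuousOn
    hc.continuousOn
  refine ⟨max C 0, fun t => ?_⟩
  by_cases ht : t ∈ Icc (1 : ℝ) 2
  · exact (hC t ht).trans (le_max_left _ _)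
  · rw [deriv_smoothTransition_eq_zero, zero_mul, abs_zero]
    · exact le_max_right _ _
    · rcases not_and_or.1 ht with h | h
      · left; linarith
      · right; linarith

/-! ### Cutoffs vanishing near the disc -/

/-- The smooth cutoff function `S(k(|x - x₀|² - R²) - 1)` away from `B_R`. -/
def cutoff (x₀ : Plane) (R k : ℝ) (x : Plane) : ℝ :=
  Real.smoothTransition (k * (‖x - x₀‖ ^ 2 - R ^ 2) - 1)

section cutoff

variable {x₀ : Plane} {R k : ℝ}

lemma contDiff_cutoff : ContDiff ℝ ∞ (cutoff x₀ R k) :=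
  (Real.smoothTransition.contDiff (n := ⊤)).comp
    ((contDiff_const.mul (((contDiff_id.sub contDiff_const).norm_sq ℝ).sub contDiff_const)).sub
      contDiff_const)

lemma partialDeriv_cutoff (x : Plane) (j : Fin 2) :
    partialDeriv j (cutoff x₀ R k) x
      = deriv Real.smoothTransition (k * (‖x - x₀‖ ^ 2 - R ^ 2) - 1) * (2 * k * (x - x₀) j) := by
  have h1 : HasFDerivAt (fun y : Plane => k * (‖y - x₀‖ ^ 2 - R ^ 2) - 1)
      (k • (2 • (innerSL ℝ (x - x₀)).comp (ContinuousLinearMap.id ℝ Plane))) x :=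
    (((((hasFDerivAt_id x).sub_const x₀).norm_sq).sub_const _).const_mul k).sub_const 1
  have h2 : HasDerivAt Real.smoothTransition
      (deriv Real.smoothTransition (k * (‖x - x₀‖ ^ 2 - R ^ 2) - 1))
      (k * (‖x - x₀‖ ^ 2 - R ^ 2) - 1) :=
    ((Real.smoothTransition.contDiff (n := 1)).differentiable (by simp) _).hasDerivAt
  have h3 := h2.comp_hasFDerivAt x h1
  have h4 : fderiv ℝ (cutoff x₀ R k) x = _ := h3.fderiv
  simp only [partialDeriv, h4]
  have h5 : inner ℝ (x - x₀) (EuclideanSpace.single j (1 : ℝ)) = (x - x₀) j := by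
    rw [EuclideanSpace.inner_single_right]; simp
  simp only [smul_apply, ContinuousLinearMap.comp_apply, ContinuousLinearMap.id_apply,
    innerSL_apply_apply, h5, smul_eq_mul, nsmul_eq_mul, Nat.cast_ofNat]
  ring

/-- The shift by one in the argument matters here: it keeps even the closed support off the circle,
so cut-off fields are admissible in the weak gradient condition of the exterior. -/
lemma tsupport_cutoff_subset (hk : 0 < k) :
    tsupport (cutoff x₀ R k) ⊆ (closedBall x₀ R)ᶜ := by
  have h1 : tsupport (cutoff x₀ R k) ⊆ {x | 1 ≤ k * (‖x - x₀‖ ^ 2 - R ^ 2)} := by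
    refine closure_minimal (fun x hx => ?_) (isClosed_le continuous_const (by fun_prop))
    by_contra h
    refine hx (Real.smoothTransition.zero_of_nonpos ?_)
    simp only [mem_ofPred_eq, not_le] at h
    linarith
  intro x hx hxb
  have h2 := h1 hx
  simp only [mem_ofPred_eq] at h2
  rw [mem_closedBall, dist_eq_norm] at hxb
  have : ‖x - x₀‖ ^ 2 ≤ R ^ 2 := by gcongr
  nlinarith

/-- Beyond the threshold 2 the argument of the transition exceeds 1, so the cutoff equals one and
its derivative vanishes. -/
lemma cutoff_eventually {x : Plane} (hR : 0 < R) (hx : x ∉ closedBall x₀ R) :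
    ∀ᶠ k : ℕ in Filter.atTop, 2 < (k : ℝ) * (‖x - x₀‖ ^ 2 - R ^ 2) := by
  rw [mem_closedBall, dist_eq_norm, not_le] at hx
  have hs : 0 < ‖x - x₀‖ ^ 2 - R ^ 2 := by nlinarith
  exact (tendsto_natCast_atTop_atTop.atTop_mul_const hs).eventually_gt_atTop 2

/-- A Lipschitz function vanishing on the circle is controlled by `|x - x₀|² - R²`. -/
lemma abs_le_of_eqOn_sphere_zero (hR : 0 < R) {q : Plane → ℝ} {L : ℝ≥0} (hq : LipschitzWith L q)
    (h0 : ∀ x ∈ sphere x₀ R, q x = 0) {x : Plane} (hx : x ∉ closedBall x₀ R) :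
    |q x| ≤ L / R * (‖x - x₀‖ ^ 2 - R ^ 2) := by
  rw [mem_closedBall, dist_eq_norm, not_le] at hx
  have hne : x ≠ x₀ := by rintro rfl; simp at hx; linarith
  have h1 := hq.dist_le_mul x (radialProj x₀ R x)
  rw [h0 _ (radialProj_mem_sphere hR hne), Real.dist_eq, sub_zero] at h1
  have h2 : dist x (radialProj x₀ R x) = ‖x - x₀‖ - R := by
    rw [dist_eq_norm, radialProj, ← sub_sub]
    have : x - x₀ - (R / ‖x - x₀‖) • (x - x₀) = (1 - R / ‖x - x₀‖) • (x - x₀) := by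
      rw [sub_smul, one_smul]
    have hp : 0 < ‖x - x₀‖ := hR.trans hx
    rw [this, norm_smul, Real.norm_eq_abs, abs_of_nonneg]
    · field_simp
    · rw [sub_nonneg, div_le_one hp]; exact hx.le
  rw [h2] at h1
  refine h1.trans ?_
  rw [div_mul_eq_mul_div, le_div_iff₀ hR, mul_assoc]
  refine mul_le_mul_of_nonneg_left ?_ L.2
  nlinarith

end cutoff

/-! ### Existence and uniqueness of the outer trace -/

section trace

variable {D : Set Plane} {x₀ : Plane} {R : ℝ}

/-- Green's formula for fields that are tangential on the circle. -/
lemma green_tangential (hDfin : volume D ≠ ⊤) (hR : 0 < R)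
    {η : Fin 2 → Plane → ℝ} (hη : ∀ j, IsTestFunction D (η j))
    (htan : ∀ x ∈ sphere x₀ R, ∑ j, η j x * (x - x₀) j = 0) (v : VR D x₀ R) :
    ∑ j, ∫ x in D \ closedBall x₀ R,
      (v.fn x * partialDeriv j (η j) x + v.grad x j * η j x) = 0 := by
  set U := D \ closedBall x₀ R with hU
  have hUD : U ⊆ D := sdiff_subset
  have : IsFiniteMeasure (volume.restrict U) :=
    ⟨by rw [Measure.restrict_apply_univ]; exact (measure_mono hUD).trans_lt hDfin.lt_top⟩
  set A : Plane → ℝ := fun x => ∑ j, (v.fn x * partialDeriv j (η j) x + v.grad x j * η j x)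
    with hA
  set q : Plane → ℝ := fun x => ∑ j, η j x * (x - x₀) j with hq
  have hterm : ∀ j, Integrable
      (fun x => v.fn x * partialDeriv j (η j) x + v.grad x j * η j x) (volume.restrict U) :=
    fun j => (integrable_mul_of_L2 v.memLp_fn ((hη j).memLp_partialDeriv j _)).add
        (integrable_mul_of_L2 (memLp_coord v.memLp_grad j) ((hη j).memLp _))
  have hAint : Integrable A (volume.restrict U) := integrable_finsetSum _ fun j _ => hterm j
  have hqs : ContDiff ℝ ∞ q :=
    ContDiff.sum fun j _ => (hη j).smooth.mul (contDiff_coord_sub x₀ j)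
  have hqc : HasCompactSupport q := by
    have h0 : HasCompactSupport fun x => η 0 x * (x - x₀) 0 := (hη 0).compact.mul_right
    have h1 : HasCompactSupport fun x => η 1 x * (x - x₀) 1 := (hη 1).compact.mul_right
    have := h0.add h1
    have hq' : q = (fun x => η 0 x * (x - x₀) 0) + fun x => η 1 x * (x - x₀) 1 := by
      ext x
      simp only [hq, Fin.sum_univ_two, Pi.add_apply]
    rw [hq']
    exact this
  obtain ⟨L, hL⟩ := ContDiff.lipschitzWith_of_hasCompactSupport hqc hqs (by simp)
  obtain ⟨C, hC⟩ := exists_bound_deriv_smoothTransition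
  -- This is the Green integrand of the field `cutoff • η`. The gradient of the cutoff is radial, so
  -- it meets `η` only through `q = η · (x - x₀)`.
  let F : ℕ → Plane → ℝ := fun k x => cutoff x₀ R k x * A x +
    v.fn x * (deriv Real.smoothTransition (k * (‖x - x₀‖ ^ 2 - R ^ 2) - 1) * (2 * k) * q x)
  have hF0 : ∀ k : ℕ, 0 < k → ∫ x in U, F k x = 0 := by
    intro k hk
    have hk' : (0 : ℝ) < k := by exact_mod_cast hk
    have htest : ∀ j, IsTestFunction U (fun x => cutoff x₀ R k x * η j x) := fun j =>
      ⟨contDiff_cutoff.mul (hη j).smooth, (hη j).compact.mul_left, fun x hx =>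
        ⟨(hη j).supp (tsupport_mul_subset_right hx),
          tsupport_cutoff_subset hk' (tsupport_mul_subset_left hx)⟩⟩
    have hz := (hasWeakGradient_iff v.memLp_fn v.memLp_grad).1 v.2
    have h1 : ∀ x, F k x = ∑ j, (v.fn x * partialDeriv j (fun x => cutoff x₀ R k x * η j x) x
        + v.grad x j * (cutoff x₀ R k x * η j x)) := by
      intro x
      have hd : DifferentiableAt ℝ (cutoff x₀ R (k : ℝ)) x :=
        contDiff_cutoff.differentiable (by simp) x
      simp only [F, hA, hq, Fin.sum_univ_two]
      rw [partialDeriv_mul hd ((hη 0).differentiable x),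
        partialDeriv_mul hd ((hη 1).differentiable x), partialDeriv_cutoff, partialDeriv_cutoff]
      ring
    simp only [h1]
    rw [integral_finsetSum]
    · exact Finset.sum_eq_zero fun j _ => hz _ (htest j) j
    · exact fun j _ => (integrable_mul_of_L2 v.memLp_fn ((htest j).memLp_partialDeriv j _)).add
        (integrable_mul_of_L2 (memLp_coord v.memLp_grad j) ((htest j).memLp _))
  have hmeas : ∀ k : ℕ, AEStronglyMeasurable (F k) (volume.restrict U) := by
    intro k
    refine (contDiff_cutoff.continuous.aestronglyMeasurable.mul hAint.1).add
      (v.memLp_fn.1.mul (Continuous.aestronglyMeasurable ?_))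
    have h1 : Continuous (deriv Real.smoothTransition) :=
      (Real.smoothTransition.contDiff (n := 1)).continuous_deriv le_rfl
    exact ((h1.comp (by fun_prop)).mul continuous_const).mul hqs.continuous
  have hUm : ∀ᵐ x ∂(volume.restrict U), x ∉ closedBall x₀ R := by
    have h1 : ∀ᵐ x ∂(volume.restrict (closedBall x₀ R)ᶜ), x ∈ (closedBall x₀ R)ᶜ :=
      ae_restrict_mem isClosed_closedBall.measurableSet.compl
    exact (ae_mono (Measure.restrict_mono (fun x hx => hx.2) le_rfl)) h1
  -- Dominated convergence. By tangency `q` vanishes on the circle, and being Lipschitz it is at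
  -- most `L/R` times `s = |x - x₀|² - R²`. Since `|S'| k s ≤ C`, the term with the factor `2k` is
  -- bounded by `2C L/R |v|`, which is integrable because `U` has finite measure.
  have hlim : Filter.Tendsto (fun k => ∫ x in U, F k x) Filter.atTop (nhds (∫ x in U, A x)) := by
    refine tendsto_integral_of_dominated_convergence
      (fun x => |A x| + |v.fn x| * (2 * C * (L / R))) hmeas ?_ ?_ ?_
    · exact hAint.abs.add ((v.memLp_fn.integrable (by norm_num)).abs.mul_const _)
    · intro k
      filter_upwards [hUm] with x hx
      refine (abs_add_le _ _).trans (add_le_add ?_ ?_)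
      · rw [abs_mul]
        refine mul_le_of_le_one_left (abs_nonneg _) ?_
        rw [cutoff, abs_of_nonneg (Real.smoothTransition.nonneg _)]
        exact Real.smoothTransition.le_one _
      · rw [abs_mul]
        refine mul_le_mul_of_nonneg_left ?_ (abs_nonneg _)
        have hb := abs_le_of_eqOn_sphere_zero hR hL htan hx
        have hCk := hC (k * (‖x - x₀‖ ^ 2 - R ^ 2))
        set s := ‖x - x₀‖ ^ 2 - R ^ 2
        set d := deriv Real.smoothTransition (k * s - 1)
        have hs : 0 ≤ s := by
          rw [mem_closedBall, dist_eq_norm, not_le] at hx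
          simp only [s]; nlinarith
        have hk0 : (0 : ℝ) ≤ k := Nat.cast_nonneg k
        rw [abs_mul, abs_mul, abs_of_nonneg (by positivity : (0 : ℝ) ≤ 2 * k)]
        rw [abs_mul, abs_of_nonneg (by positivity : (0 : ℝ) ≤ k * s)] at hCk
        calc |d| * (2 * k) * |q x| ≤ |d| * (2 * k) * (L / R * s) := by gcongr
          _ = 2 * (|d| * (k * s)) * (L / R) := by ring
          _ ≤ 2 * C * (L / R) := by gcongr
    · filter_upwards [hUm] with x hx
      refine tendsto_const_nhds.congr' ?_
      filter_upwards [cutoff_eventually hR hx] with k hk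
      simp only [F, cutoff]
      rw [Real.smoothTransition.one_of_one_le (by linarith),
        deriv_smoothTransition_eq_zero (Or.inr (by linarith))]
      ring
  have h0 : ∫ x in U, A x = 0 := by
    refine tendsto_nhds_unique hlim (tendsto_const_nhds.congr' ?_)
    filter_upwards [Filter.eventually_gt_atTop 0] with k hk
    exact (hF0 k hk).symm
  rw [← h0, hA, integral_finsetSum _ fun j _ => hterm j]

lemma radialProj_homothety {x : Plane} {t : ℝ} (ht : 0 < t) :
    radialProj x₀ R (x₀ + t • (x - x₀)) = radialProj x₀ R x := by
  simp only [radialProj, add_sub_cancel_left, norm_smul, Real.norm_eq_abs, abs_of_pos ht, smul_smul]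
  congr 2
  rcases eq_or_ne ‖x - x₀‖ 0 with h | h
  · simp [h]
  · field_simp

/-- Functions of the radial projection have zero radial derivative. -/
lemma fderiv_comp_radialProj {f : Plane → ℝ} (hf : ContDiff ℝ ∞ f) {x : Plane} (hx : x ≠ x₀) :
    fderiv ℝ (fun y => f (radialProj x₀ R y)) x (x - x₀) = 0 := by
  have hd : DifferentiableAt ℝ (fun y => f (radialProj x₀ R y)) x :=
    (hf.contDiffAt.comp x (contDiffAt_radialProj hx)).differentiableAt (by simp)
  have hl : HasDerivAt (fun t : ℝ => x₀ + t • (x - x₀)) (x - x₀) 1 := by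
    simpa using ((hasDerivAt_id (1 : ℝ)).smul_const (x - x₀)).const_add x₀
  have h1 : HasDerivAt (fun t : ℝ => f (radialProj x₀ R (x₀ + t • (x - x₀))))
      (fderiv ℝ (fun y => f (radialProj x₀ R y)) x (x - x₀)) 1 := by
    have h3 : HasFDerivAt (fun y => f (radialProj x₀ R y))
        (fderiv ℝ (fun y => f (radialProj x₀ R y)) x) (x₀ + (1 : ℝ) • (x - x₀)) := by
      rw [one_smul, add_sub_cancel]
      exact hd.hasFDerivAt
    exact HasFDerivAt.comp_hasDerivAt (l := fun y => f (radialProj x₀ R y)) 1 h3 hl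
  have h2 : HasDerivAt (fun t : ℝ => f (radialProj x₀ R (x₀ + t • (x - x₀)))) 0 1 := by
    refine (hasDerivAt_const (1 : ℝ) (f (radialProj x₀ R x))).congr_of_eventuallyEq ?_
    filter_upwards [Ioi_mem_nhds one_pos] with t ht
    rw [radialProj_homothety ht]
  exact h1.unique h2

/-- On the circle, the field `ψ eᵢ` differs by a tangential field from a radial field `Y = ρ (x -
x₀) Φ(P x)`, where `P` is the radial projection. By `green_tangential` both fields have the same
Green integral. As `Φ ∘ P` has no radial derivative, that of `Y` is `∫ q Φ(P x) dx` with `q ∈ L²`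
independent of `ψ`. Pushing `q` forward along `P` gives the trace as an `L²` density on the circle.
-/
lemma exists_isOuterTrace (hD : IsOpen D) (hDfin : volume D ≠ ⊤) (hR : 0 < R)
    (hBD : closedBall x₀ R ⊆ D) (v : VR D x₀ R) : ∃ f, IsOuterTrace v f := by
  set U := D \ closedBall x₀ R with hU
  have hUm : MeasurableSet U := hD.measurableSet.diff isClosed_closedBall.measurableSet
  have hW : IsOpen (D \ {x₀}) := hD.sdiff isClosed_singleton
  have hSW : sphere x₀ R ⊆ D \ {x₀} := fun x hx =>
    ⟨hBD (sphere_subset_closedBall hx), by rintro rfl; simp at hx; linarith⟩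
  obtain ⟨ρ, hρ, hρ1⟩ := exists_isTestFunction_eqOn_one (isCompact_sphere x₀ R) hW hSW
  obtain ⟨R', hR', hρR'⟩ := hρ.compact.isBounded.subset_ball_lt 0 x₀
  set σ : Fin 2 → Plane → ℝ := fun j x => ρ x * (x - x₀) j with hσ
  have hσt : ∀ j, IsTestFunction (D \ {x₀}) (σ j) := fun j =>
    hρ.mul_contDiff (contDiff_coord_sub x₀ j)
  have hσs : ∀ j, tsupport (σ j) ⊆ ball x₀ R' := fun j => tsupport_mul_subset_left.trans hρR'
  set q : Plane → ℝ := fun x => ∑ j, (v.fn x * partialDeriv j (σ j) x + v.grad x j * σ j x) with hq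
  have hq2 : MemLp q 2 (volume.restrict U) := by
    refine memLp_finsetSum _ fun j _ => MemLp.add ?_ ?_
    · exact MemLp.mul' (p := 2) (q := ⊤)
        (((hσt j).continuous_partialDeriv j).memLp_of_hasCompactSupport
          ((hσt j).compact.fderiv_apply ℝ _)) v.memLp_fn
    · exact MemLp.mul' (p := 2) (q := ⊤) ((hσt j).smooth.continuous.memLp_of_hasCompactSupport
        (hσt j).compact) (memLp_coord v.memLp_grad j)
  -- Domination by arc length is available only on a bounded set, which is why the support of `ρ` is
  -- first enclosed in a ball.
  have hle : (volume.restrict (U ∩ ball x₀ R')).map (radialProj x₀ R)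
      ≤ ENNReal.ofReal (R' ^ 2 / R) • arcLength x₀ R := by
    refine (Measure.map_mono (Measure.restrict_mono ?_ le_rfl) measurable_radialProj).trans
      (map_radialProj_le hR hR')
    rintro x ⟨hxU, hxb⟩
    refine ⟨hxb, ?_⟩
    rintro rfl
    exact hxU.2 (mem_closedBall_self hR.le)
  obtain ⟨f, hf⟩ := exists_density_of_map_le measurable_radialProj ENNReal.ofReal_ne_top hle
    (hq2.mono_measure (Measure.restrict_mono inter_subset_left le_rfl))
  -- The density pairs with `ψ (x - x₀)ᵢ / R²`. One factor `-1/R` forms the normal pointing out of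
  -- `U`, the other is absorbed in the trace.
  refine ⟨(-R⁻¹ : ℝ) • f, fun ψ hψ i => ?_⟩
  -- The factor `R⁻²` cancels `|x - x₀|²` on the circle and so makes `ψ eᵢ - Y` tangential there.
  set Φ : Plane → ℝ := fun y => ψ y * (y - x₀) i * (R⁻¹ * R⁻¹) with hΦ
  have hΦs : ContDiff ℝ ∞ Φ := (hψ.smooth.mul (contDiff_coord_sub x₀ i)).mul contDiff_const
  have hΦP : ∀ x, x ≠ x₀ → DifferentiableAt ℝ (fun y => Φ (radialProj x₀ R y)) x := fun x hx =>
    (hΦs.contDiffAt.comp x (contDiffAt_radialProj hx)).differentiableAt (by simp)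
  set Y : Fin 2 → Plane → ℝ := fun j x => σ j x * Φ (radialProj x₀ R x) with hY
  have hYt : ∀ j, IsTestFunction D (Y j) := fun j => by
    refine IsTestFunction.mono ((hσt j).mul_contDiffOn hW fun x hx => ?_) sdiff_subset
    exact (hΦs.contDiffAt.comp x (contDiffAt_radialProj hx.2)).contDiffWithinAt
  have hYint : ∫ x in U, ∑ j, (v.fn x * partialDeriv j (Y j) x + v.grad x j * Y j x)
      = ∫ x, f x * Φ x ∂(arcLength x₀ R) := by
    rw [← hf Φ ((hψ.smooth.mul (contDiff_coord_sub x₀ i)).mul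
      contDiff_const |>.continuous.memLp_of_hasCompactSupport
        (hψ.compact.mul_right.mul_right)),
      ← setIntegral_eq_of_subset_of_forall_sdiff_eq_zero hUm inter_subset_left]
    · refine setIntegral_congr_fun hUm fun x hx => ?_
      have hx0 : x ≠ x₀ := by
        rintro rfl
        exact hx.2 (mem_closedBall_self hR.le)
      have h1 := fderiv_comp_radialProj (R := R) hΦs hx0
      rw [fderiv_apply_eq_sum, Fin.sum_univ_two] at h1
      simp only [hY, hq, Fin.sum_univ_two]
      rw [partialDeriv_mul ((hσt 0).differentiable x) (hΦP x hx0),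
        partialDeriv_mul ((hσt 1).differentiable x) (hΦP x hx0)]
      simp only [hσ] at h1 ⊢
      linear_combination v.fn x * ρ x * h1
    · rintro x ⟨hxU, hx⟩
      have hx' : x ∉ ball x₀ R' := fun h => hx ⟨hxU, h⟩
      have h1 : q x = 0 := Finset.sum_eq_zero fun j _ => by
        rw [partialDeriv_eq_zero (fun h => hx' (hσs j h)),
          image_eq_zero_of_notMem_tsupport (fun h => hx' (hσs j h))]
        simp
      rw [h1, zero_mul]
  have htang := green_tangential hDfin hR
    (η := fun j x => (if j = i then 1 else 0) * ψ x - Y j x)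
    (fun j => (hψ.const_mul _).sub (hYt j)) (fun x hx => by
      have hn : ∑ j, (x - x₀) j * (x - x₀) j = R ^ 2 := by
        rw [sum_sq_eq_norm_sq, ← dist_eq_norm, mem_sphere.1 hx]
      have h1 : ∑ j, ((if j = i then 1 else 0) * ψ x - Y j x) * (x - x₀) j
          = ψ x * (x - x₀) i - Φ x * ∑ j, (x - x₀) j * (x - x₀) j := by
        simp only [sub_mul, Finset.sum_sub_distrib, hY, hσ, hρ1 x hx,
          radialProj_of_mem_sphere hR hx, Finset.mul_sum]
        congr 1
        · simp
        · exact Finset.sum_congr rfl fun j _ => by ring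
      rw [h1, hn, hΦ]
      field_simp
      ring) v
  have hsplit : ∀ j, ∫ x in U, (v.fn x * partialDeriv j
        (fun x => (if j = i then 1 else 0) * ψ x - Y j x) x +
        v.grad x j * ((if j = i then 1 else 0) * ψ x - Y j x))
      = (if j = i then 1 else 0) * (∫ x in U, (v.fn x * partialDeriv j ψ x + v.grad x j * ψ x)) -
        ∫ x in U, (v.fn x * partialDeriv j (Y j) x + v.grad x j * Y j x) := by
    intro j
    rw [← integral_const_mul, ← integral_sub]
    · refine integral_congr_ae (Filter.Eventually.of_forall fun x => ?_)
      simp only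
      rw [partialDeriv_sub ((hψ.const_mul _).differentiable x) ((hYt j).differentiable x),
        partialDeriv_const_mul (hψ.differentiable x)]
      ring
    · exact ((integrable_mul_of_L2 v.memLp_fn (hψ.memLp_partialDeriv j _)).add
        (integrable_mul_of_L2 (memLp_coord v.memLp_grad j) (hψ.memLp _))).const_mul _
    · exact (integrable_mul_of_L2 v.memLp_fn ((hYt j).memLp_partialDeriv j _)).add
        (integrable_mul_of_L2 (memLp_coord v.memLp_grad j) ((hYt j).memLp _))
  simp only [← hU] at htang
  rw [Finset.sum_congr rfl fun j _ => hsplit j, Finset.sum_sub_distrib, sub_eq_zero,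
    ← integral_finsetSum, hYint] at htang
  · simp only [ite_mul, one_mul, zero_mul, Finset.sum_ite_eq', Finset.mem_univ, if_true] at htang
    rw [htang]
    refine integral_congr_ae ?_
    filter_upwards [Lp.coeFn_smul (-R⁻¹ : ℝ) f] with x hx
    rw [hx, hΦ]
    simp only [Pi.smul_apply, smul_eq_mul, PiLp.neg_apply, PiLp.smul_apply]
    ring
  · exact fun j _ => (integrable_mul_of_L2 v.memLp_fn ((hYt j).memLp_partialDeriv j _)).add
        (integrable_mul_of_L2 (memLp_coord v.memLp_grad j) ((hYt j).memLp _))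

/-- Testing shows that `(f - g) νᵢ = 0` almost everywhere for both `i`. The normal never vanishes on
the circle, which carries all of `arcLength` and lies in `D`. -/
lemma isOuterTrace_unique (hD : IsOpen D) (hR : 0 < R) (hBD : closedBall x₀ R ⊆ D)
    {v : VR D x₀ R} {f g : L2Circle x₀ R} (hf : IsOuterTrace v f) (hg : IsOuterTrace v g) :
    f = g := by
  set ν : Plane → Plane := fun x => -(R⁻¹ • (x - x₀)) with hν
  have hνc : ∀ i, Continuous fun x => ν x i := fun i => by
    simp only [hν]
    fun_prop
  have hint : ∀ (f : L2Circle x₀ R) (ψ : Plane → ℝ), IsTestFunction D ψ → ∀ i,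
      Integrable (fun x => f x * ψ x * ν x i) (arcLength x₀ R) := fun f ψ hψ i => by
    have h1 : IsTestFunction D fun x => ψ x * ν x i := hψ.mul_contDiff (by
      simp only [hν, PiLp.neg_apply, PiLp.smul_apply]
      exact (contDiff_const.mul (contDiff_coord_sub x₀ i)).neg)
    simpa only [mul_assoc] using integrable_mul_of_L2 (Lp.memLp f) (h1.memLp _)
  have hfI : ∀ f : L2Circle x₀ R, Integrable f (arcLength x₀ R) := fun f =>
    (Lp.memLp f).integrable (by norm_num)
  have hae : ∀ i, ∀ᵐ x ∂(arcLength x₀ R), x ∈ D → (f x - g x) * ν x i = 0 := by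
    intro i
    refine hD.ae_eq_zero_of_integral_contDiff_smul_eq_zero ?_ fun ψ h1 h2 h3 => ?_
    · exact (((hfI f).sub (hfI g)).locallyIntegrable.locallyIntegrableOn D).mul_continuousOn
        (hνc i).continuousOn hD.isLocallyClosed
    · have hψ : IsTestFunction D ψ := ⟨h1, h2, h3⟩
      have h4 := (hf ψ hψ i).symm.trans (hg ψ hψ i)
      rw [← sub_eq_zero, ← integral_sub (hint f ψ hψ i) (hint g ψ hψ i)] at h4
      rw [← h4]
      refine integral_congr_ae (Filter.Eventually.of_forall fun x => ?_)
      simp only [smul_eq_mul]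
      ring
  refine Lp.ext ?_
  filter_upwards [hae 0, hae 1, ae_arcLength_mem_sphere hR] with x hx0 hx1 hx
  have hxD := hBD (sphere_subset_closedBall hx)
  have hn : ∑ j, (x - x₀) j * (x - x₀) j = R ^ 2 := by
    rw [sum_sq_eq_norm_sq, ← dist_eq_norm, mem_sphere.1 hx]
  rw [Fin.sum_univ_two] at hn
  have h0 := hx0 hxD
  have h1 := hx1 hxD
  simp only [hν, PiLp.neg_apply, PiLp.smul_apply, smul_eq_mul] at h0 h1
  have h2 : (f x - g x) * R = 0 := by
    have : (f x - g x) * R = -((f x - g x) * -(R⁻¹ * (x - x₀) 0) * (x - x₀) 0 +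
      (f x - g x) * -(R⁻¹ * (x - x₀) 1) * (x - x₀) 1) := by
      field_simp
      linear_combination -(f x - g x) * hn
    rw [this, h0, h1]
    simp
  exact sub_eq_zero.1 ((mul_eq_zero.1 h2).resolve_right hR.ne')

end trace

/-! ### Elements of `H¹` given by functions -/

/-- The element of `H¹(U)` given by a function and its weak gradient. -/
def H1.ofFn {U : Set Plane} {u : Plane → ℝ} {G : Plane → Plane}
    (hu : MemLp u 2 (volume.restrict U)) (hG : MemLp G 2 (volume.restrict U))
    (h : ∀ ψ : Plane → ℝ, IsTestFunction U ψ → ∀ i : Fin 2,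
      ∫ x in U, (u x * partialDeriv i ψ x + G x i * ψ x) = 0) : H1 U :=
  ⟨WithLp.toLp 2 (hu.toLp u, hG.toLp G), by
    refine (hasWeakGradient_iff (Lp.memLp _) (Lp.memLp _)).2 fun ψ hψ i => ?_
    rw [← h ψ hψ i]
    refine integral_congr_ae ?_
    filter_upwards [hu.coeFn_toLp, hG.coeFn_toLp] with x h1 h2
    exact congrArg₂ (fun a (b : Plane) => a * partialDeriv i ψ x + b i * ψ x) h1 h2⟩

section ofFn

variable {U : Set Plane} {u : Plane → ℝ} {G : Plane → Plane}
  {hu : MemLp u 2 (volume.restrict U)} {hG : MemLp G 2 (volume.restrict U)}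
  {h : ∀ ψ : Plane → ℝ, IsTestFunction U ψ → ∀ i : Fin 2,
      ∫ x in U, (u x * partialDeriv i ψ x + G x i * ψ x) = 0}

lemma H1.fn_ofFn : (H1.ofFn hu hG h).fn =ᵐ[volume.restrict U] u := hu.coeFn_toLp

lemma H1.grad_ofFn : (H1.ofFn hu hG h).grad =ᵐ[volume.restrict U] G := hG.coeFn_toLp

end ofFn

lemma H1.ext {U : Set Plane} {u v : H1 U} (h : u.fn =ᵐ[volume.restrict U] v.fn)
    (h' : u.grad =ᵐ[volume.restrict U] v.grad) : u = v := by
  have h1 : (u : L2Pair U).fst = (v : L2Pair U).fst := Lp.ext h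
  have h2 : (u : L2Pair U).snd = (v : L2Pair U).snd := Lp.ext h'
  exact Subtype.ext (WithLp.ofLp_injective 2 (Prod.ext h1 h2))

/-! ### Reflection in the circle -/

section reflection

open EuclideanGeometry

variable {x₀ : Plane} {R : ℝ}

/-- The derivative of the inversion in the circle `∂B_R`. -/
def invDeriv (x₀ : Plane) (R : ℝ) (x : Plane) : Plane →L[ℝ] Plane :=
  (R / dist x x₀) ^ 2 • ((Submodule.span ℝ {x - x₀})ᗮ.reflection : Plane →L[ℝ] Plane)

lemma hasFDerivAt_inversion' {x : Plane} (hx : x ≠ x₀) :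
    HasFDerivAt (inversion x₀ R) (invDeriv x₀ R x) x := hasFDerivAt_inversion hx

lemma abs_det_invDeriv (x : Plane) : |(invDeriv x₀ R x).det| = (R / dist x x₀) ^ 4 := by
  have h1 : (invDeriv x₀ R x).det = ((R / dist x x₀) ^ 2) ^ 2 *
      LinearMap.det (Submodule.span ℝ {x - x₀})ᗮ.reflection.toLinearMap := by
    rw [ContinuousLinearMap.det, invDeriv, ContinuousLinearMap.toLinearMap_smul,
      LinearMap.det_smul, finrank_euclideanSpace, Fintype.card_fin]
    rfl
  rw [h1, Submodule.det_reflection, abs_mul, abs_pow (-1 : ℝ), abs_neg, abs_one, one_pow, mul_one,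
    abs_of_nonneg (by positivity)]
  ring

lemma invDeriv_apply {x : Plane} (w : Plane) : invDeriv x₀ R x w
    = (R / dist x x₀) ^ 2 • (w - (2 * (inner ℝ (x - x₀) w / ‖x - x₀‖ ^ 2)) • (x - x₀)) := by
  have h1 : invDeriv x₀ R x w
      = (R / dist x x₀) ^ 2 • (Submodule.span ℝ {x - x₀})ᗮ.reflection w := rfl
  rw [h1, Submodule.reflection_orthogonal_apply, Submodule.reflection_singleton_apply, neg_sub,
    two_smul, ← add_smul, two_mul]
  rfl

lemma norm_invDeriv_apply (x w : Plane) : ‖invDeriv x₀ R x w‖ = (R / dist x x₀) ^ 2 * ‖w‖ := by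
  have h1 : invDeriv x₀ R x w
      = (R / dist x x₀) ^ 2 • (Submodule.span ℝ {x - x₀})ᗮ.reflection w := rfl
  rw [h1, norm_smul, LinearIsometryEquiv.norm_map, Real.norm_eq_abs, abs_of_nonneg (by positivity)]

lemma inner_invDeriv_left (x u w : Plane) :
    inner ℝ (invDeriv x₀ R x u) w = inner ℝ u (invDeriv x₀ R x w) := by
  simp only [invDeriv_apply, inner_smul_left, inner_smul_right, inner_sub_left, inner_sub_right]
  simp only [real_inner_comm, RCLike.conj_to_real]
  rw [real_inner_comm u]
  ring

lemma invDeriv_invDeriv (x w : Plane) :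
    invDeriv x₀ R x (invDeriv x₀ R x w) = (R / dist x x₀) ^ 4 • w := by
  have h1 : ∀ w, invDeriv x₀ R x w
      = (R / dist x x₀) ^ 2 • (Submodule.span ℝ {x - x₀})ᗮ.reflection w := fun w => rfl
  rw [h1, h1, map_smul, Submodule.reflection_reflection, smul_smul]
  congr 1
  ring

/-- The derivatives at a point and at its reflection differ by a factor. -/
lemma invDeriv_eq_smul (hR : 0 < R) {x : Plane} (hx : x ≠ x₀) :
    invDeriv x₀ R x = (R / dist x x₀) ^ 4 • invDeriv x₀ R (inversion x₀ R x) := by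
  have hd : 0 < dist x x₀ := dist_pos.2 hx
  have hs : Submodule.span ℝ {inversion x₀ R x - x₀} = Submodule.span ℝ {x - x₀} := by
    have : inversion x₀ R x - x₀ = (R / dist x x₀) ^ 2 • (x - x₀) := inversion_vsub_center x₀ R x
    rw [this]
    exact Submodule.span_singleton_smul_eq (IsUnit.mk0 _ (by positivity)) _
  simp only [invDeriv, hs]
  rw [dist_inversion_center, smul_smul]
  congr 1
  field_simp

/-- The `j`-th component of the image of the `i`-th unit vector under the derivative of the
inversion. -/
def invCoeff (x₀ : Plane) (R : ℝ) (i j : Fin 2) (y : Plane) : ℝ :=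
  R ^ 2 * ((if i = j then 1 else 0) * (‖y - x₀‖ ^ 2)⁻¹
    - 2 * ((y - x₀) i * (y - x₀) j * ((‖y - x₀‖ ^ 2)⁻¹ * (‖y - x₀‖ ^ 2)⁻¹)))

lemma invDeriv_single (y : Plane) (i j : Fin 2) :
    invDeriv x₀ R y (EuclideanSpace.single i 1) j = invCoeff x₀ R i j y := by
  rw [invDeriv_apply, EuclideanSpace.inner_single_right]
  simp only [PiLp.smul_apply, PiLp.sub_apply, smul_eq_mul, invCoeff, dist_eq_norm]
  simp only [RCLike.conj_to_real, PiLp.single_apply, eq_comm, one_mul]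
  ring

lemma contDiffOn_invCoeff (i j : Fin 2) : ContDiffOn ℝ ∞ (invCoeff x₀ R i j) {x₀}ᶜ := by
  have hN : ContDiffOn ℝ ∞ (fun y : Plane => (‖y - x₀‖ ^ 2)⁻¹) {x₀}ᶜ := fun y hy =>
    (((contDiff_id.sub contDiff_const).norm_sq ℝ).contDiffAt.inv
      (by simpa [sub_eq_zero] using hy)).contDiffWithinAt
  exact contDiffOn_const.mul ((contDiffOn_const.mul hN).sub (contDiffOn_const.mul
    ((((contDiff_coord_sub x₀ i).mul (contDiff_coord_sub x₀ j)).contDiffOn).mul (hN.mul hN))))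

lemma partialDeriv_inv_norm_sq {y : Plane} (hy : y ≠ x₀) (j : Fin 2) :
    partialDeriv j (fun y : Plane => (‖y - x₀‖ ^ 2)⁻¹) y
      = -(2 * (y - x₀) j * ((‖y - x₀‖ ^ 2)⁻¹ * (‖y - x₀‖ ^ 2)⁻¹)) := by
  have h0 : ‖y - x₀‖ ^ 2 ≠ 0 := by simpa [sub_eq_zero] using hy
  have h3 := (hasDerivAt_inv h0).comp_hasFDerivAt y ((hasFDerivAt_id y).sub_const x₀).norm_sq
  have h4 : fderiv ℝ (fun y : Plane => (‖y - x₀‖ ^ 2)⁻¹) y = _ := h3.fderiv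
  have h5 : inner ℝ (y - x₀) (EuclideanSpace.single j (1 : ℝ)) = (y - x₀) j := by
    rw [EuclideanSpace.inner_single_right]; simp
  simp only [partialDeriv, h4]
  simp only [smul_apply, ContinuousLinearMap.comp_apply, ContinuousLinearMap.id_apply,
    innerSL_apply_apply, id_eq, h5, smul_eq_mul, nsmul_eq_mul, Nat.cast_ofNat]
  field_simp

/-- The components of the inversion of the plane are harmonic. -/
lemma sum_partialDeriv_invCoeff {y : Plane} (hy : y ≠ x₀) (i : Fin 2) :
    ∑ j, partialDeriv j (invCoeff x₀ R i j) y = 0 := by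
  have hc : ∀ j, DifferentiableAt ℝ (fun y : Plane => (y - x₀) j) y := fun j =>
    (contDiff_coord_sub x₀ j).differentiable (by simp) y
  have hM : DifferentiableAt ℝ (fun y : Plane => (‖y - x₀‖ ^ 2)⁻¹) y :=
    (((contDiff_id.sub contDiff_const).norm_sq ℝ).contDiffAt.inv
      (by simpa [sub_eq_zero] using hy) : ContDiffAt ℝ ∞ _ y).differentiableAt (by simp)
  have h0 : ‖y - x₀‖ ^ 2 ≠ 0 := by simpa [sub_eq_zero] using hy
  have key : ∀ j, partialDeriv j (invCoeff x₀ R i j) y = R ^ 2 * ((if i = j then 1 else 0) *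
      -(2 * (y - x₀) j * ((‖y - x₀‖ ^ 2)⁻¹ * (‖y - x₀‖ ^ 2)⁻¹)) -
      2 * ((y - x₀) i * (y - x₀) j * (2 * ((‖y - x₀‖ ^ 2)⁻¹ *
        -(2 * (y - x₀) j * ((‖y - x₀‖ ^ 2)⁻¹ * (‖y - x₀‖ ^ 2)⁻¹)))) +
        (‖y - x₀‖ ^ 2)⁻¹ * (‖y - x₀‖ ^ 2)⁻¹ *
          ((y - x₀) i + (y - x₀) j * (if j = i then 1 else 0)))) := by
    intro j
    have e : invCoeff x₀ R i j = fun y => R ^ 2 * ((if i = j then 1 else 0) * (‖y - x₀‖ ^ 2)⁻¹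
      - 2 * ((y - x₀) i * (y - x₀) j * ((‖y - x₀‖ ^ 2)⁻¹ * (‖y - x₀‖ ^ 2)⁻¹))) := rfl
    rw [e, partialDeriv_const_mul, partialDeriv_sub, partialDeriv_const_mul,
      partialDeriv_const_mul, partialDeriv_mul, partialDeriv_mul, partialDeriv_mul,
      partialDeriv_inv_norm_sq hy, partialDeriv_coord_sub, partialDeriv_coord_sub, if_pos rfl]
    · ring
    all_goals fun_prop
  have hn := sum_sq_eq_norm_sq (y - x₀)
  rw [Fin.sum_univ_two] at hn
  rw [Fin.sum_univ_two, key, key, ← hn]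
  rw [← hn] at h0
  fin_cases i <;> simp <;> field_simp <;> ring

lemma contDiffAt_inversion {y : Plane} (hy : y ≠ x₀) : ContDiffAt ℝ ∞ (inversion x₀ R) y :=
  ContDiffAt.inversion contDiffAt_const contDiffAt_const contDiffAt_id hy

lemma partialDeriv_comp_inversion {ψ : Plane → ℝ} (hψ : Differentiable ℝ ψ) {y : Plane}
    (hy : y ≠ x₀) (j : Fin 2) : partialDeriv j (fun y => ψ (inversion x₀ R y)) y
      = fderiv ℝ ψ (inversion x₀ R y) (invDeriv x₀ R y (EuclideanSpace.single j 1)) := by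
  have h := (hψ (inversion x₀ R y)).hasFDerivAt.comp y (hasFDerivAt_inversion' (R := R) hy)
  have h' : fderiv ℝ (fun y => ψ (inversion x₀ R y)) y = _ := h.fderiv
  rw [partialDeriv, h']
  rfl

/-- The reflected test field. -/
def reflTest (x₀ : Plane) (R : ℝ) (χ ψ : Plane → ℝ) (i j : Fin 2) (y : Plane) : ℝ :=
  χ y * (ψ (inversion x₀ R y) * invCoeff x₀ R i j y)

lemma isTestFunction_reflTest {D : Set Plane} (hD : IsOpen D) {χ ψ : Plane → ℝ}
    (hχ : IsTestFunction (D \ {x₀}) χ) (hψ : ContDiff ℝ ∞ ψ) (i j : Fin 2) :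
    IsTestFunction (D \ {x₀}) (reflTest x₀ R χ ψ i j) :=
  hχ.mul_contDiffOn (hD.sdiff isClosed_singleton) fun y hy =>
    ContDiffWithinAt.mul (hψ.contDiffAt.comp y (contDiffAt_inversion hy.2)).contDiffWithinAt
      ((contDiffOn_invCoeff i j).mono (fun _ h => h.2) y hy)

/-- The pointwise change of variables behind the reflection of Green's formula. -/
lemma reflTest_green (hR : 0 < R) {χ ψ : Plane → ℝ} (hχ : Differentiable ℝ χ)
    (hψ : Differentiable ℝ ψ) (i : Fin 2) (a : ℝ) (b : Plane) {x : Plane} (hx : x ≠ x₀) :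
    |(invDeriv x₀ R x).det| * ∑ j, (a * partialDeriv j (reflTest x₀ R χ ψ i j) (inversion x₀ R x)
        + b j * reflTest x₀ R χ ψ i j (inversion x₀ R x))
      = χ (inversion x₀ R x) * a * partialDeriv i ψ x
        + invDeriv x₀ R x (χ (inversion x₀ R x) • b + a • gradient χ (inversion x₀ R x)) i
          * ψ x := by
  set y := inversion x₀ R x with hy
  have hyne : y ≠ x₀ := by rwa [hy, Ne, inversion_eq_center hR.ne']
  have hyx : inversion x₀ R y = x := inversion_inversion x₀ hR.ne' x
  have hd : 0 < dist x x₀ := dist_pos.2 hx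
  have hA : DifferentiableAt ℝ (fun y => ψ (inversion x₀ R y)) y :=
    (hψ _).comp y ((contDiffAt_inversion hyne).differentiableAt (by simp))
  have hB : ∀ j, DifferentiableAt ℝ (invCoeff x₀ R i j) y := fun j =>
    ((contDiffOn_invCoeff i j).contDiffAt
      (isOpen_compl_singleton.mem_nhds hyne)).differentiableAt (by simp)
  set e : Plane := invDeriv x₀ R y (EuclideanSpace.single i 1) with he
  have hej : ∀ j, invCoeff x₀ R i j y = e j := fun j => (invDeriv_single y i j).symm
  have hterm : ∀ j, partialDeriv j (reflTest x₀ R χ ψ i j) y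
      = χ y * (ψ x * partialDeriv j (invCoeff x₀ R i j) y
        + e j * fderiv ℝ ψ x (invDeriv x₀ R y (EuclideanSpace.single j 1)))
        + ψ x * e j * partialDeriv j χ y := by
    intro j
    have e1 : reflTest x₀ R χ ψ i j
      = fun y => χ y * (ψ (inversion x₀ R y) * invCoeff x₀ R i j y) := rfl
    rw [e1, partialDeriv_mul (hχ y) (hA.fun_mul (hB j)), partialDeriv_mul hA (hB j),
      partialDeriv_comp_inversion hψ hyne, hyx, hej]
  have hval : ∀ j, reflTest x₀ R χ ψ i j y = χ y * (ψ x * e j) := fun j => by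
    rw [reflTest, hyx, hej]
  have S0 := sum_partialDeriv_invCoeff (R := R) hyne i
  -- Conformality: the derivative of the inversion is a multiple of a reflection, so its square is a
  -- scalar and the chain rule returns `∂ᵢψ`.
  have S1 : ∑ j, e j * fderiv ℝ ψ x (invDeriv x₀ R y (EuclideanSpace.single j 1))
      = (R / dist y x₀) ^ 4 * partialDeriv i ψ x := by
    have h1 := clm_apply_eq_sum ((fderiv ℝ ψ x).comp (invDeriv x₀ R y)) e
    simp only [ContinuousLinearMap.comp_apply, smul_eq_mul] at h1
    rw [← h1, he, invDeriv_invDeriv, map_smul, smul_eq_mul, partialDeriv]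
  have S2 : ∑ j, e j * partialDeriv j χ y = inner ℝ (gradient χ y) e := by
    rw [← fderiv_apply_eq_sum, gradient, InnerProductSpace.toDual_symm_apply]
  have S3 : ∑ j, b j * e j = inner ℝ b e := by
    rw [PiLp.inner_apply]
    simp [mul_comm]
  -- The Jacobians at a point and at its reflection are reciprocal.
  have hdet : |(invDeriv x₀ R x).det| * (R / dist y x₀) ^ 4 = 1 := by
    rw [abs_det_invDeriv, hy, dist_inversion_center]
    field_simp
  -- The derivatives at `x` and `y` differ by the Jacobian factor, and each is self-adjoint, so it
  -- can be moved from `w` to the unit vector.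
  have hG : ∀ w, invDeriv x₀ R x w i = |(invDeriv x₀ R x).det| * inner ℝ w e := by
    intro w
    have h1 := congrArg (fun L : Plane →L[ℝ] Plane => L w i) (invDeriv_eq_smul hR hx)
    rw [he, ← inner_invDeriv_left, EuclideanSpace.inner_single_right, abs_det_invDeriv]
    simpa using h1
  rw [hG, inner_add_left, inner_smul_left, inner_smul_left, ← S2, ← S3]
  simp only [hterm, hval]
  simp only [RCLike.conj_to_real, Fin.sum_univ_two] at S0 S1 ⊢
  linear_combination |(invDeriv x₀ R x).det| * a * χ y * ψ x * S0
    + |(invDeriv x₀ R x).det| * a * χ y * S1 + a * χ y * partialDeriv i ψ x * hdet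

/-- The derivative of the inversion reverses the normal of the circle. -/
lemma sum_invCoeff_mul_normal (hR : 0 < R) {x : Plane} (hx : x ∈ sphere x₀ R) (i : Fin 2) :
    ∑ j, invCoeff x₀ R i j x * (x - x₀) j = -(x - x₀) i := by
  have hN : ‖x - x₀‖ = R := by rw [← dist_eq_norm, Metric.mem_sphere.1 hx]
  have h1 : invDeriv x₀ R x (EuclideanSpace.single i 1)
      = EuclideanSpace.single i 1 - (2 * ((x - x₀) i / R ^ 2)) • (x - x₀) := by
    rw [invDeriv_apply, Metric.mem_sphere.1 hx, div_self hR.ne', one_pow, one_smul, hN,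
      EuclideanSpace.inner_single_right]
    simp
  have h2 : inner ℝ (x - x₀) (invDeriv x₀ R x (EuclideanSpace.single i 1)) = -(x - x₀) i := by
    rw [h1, inner_sub_right, inner_smul_right, real_inner_self_eq_norm_sq, hN,
      EuclideanSpace.inner_single_right]
    simp only [conj_trivial, one_mul]
    field_simp
    ring
  rw [← h2, PiLp.inner_apply]
  refine Finset.sum_congr rfl fun j _ => ?_
  rw [invDeriv_single]
  simp

lemma image_inversion_ball (hR : 0 < R) :
    inversion x₀ R '' (ball x₀ R \ {x₀}) = (closedBall x₀ R)ᶜ := by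
  ext y
  constructor
  · rintro ⟨x, ⟨hx, hx0⟩, rfl⟩
    have hd : 0 < dist x x₀ := dist_pos.2 hx0
    rw [mem_ball] at hx
    rw [mem_compl_iff, mem_closedBall, dist_inversion_center, not_le, lt_div_iff₀ hd]
    nlinarith
  · intro hy
    rw [mem_compl_iff, mem_closedBall, not_le] at hy
    have hd : 0 < dist y x₀ := hR.trans hy
    refine ⟨inversion x₀ R y, ⟨?_, ?_⟩, inversion_inversion x₀ hR.ne' y⟩
    · rw [mem_ball, dist_inversion_center, div_lt_iff₀ hd]
      nlinarith
    · rw [mem_singleton_iff, inversion_eq_center hR.ne']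
      exact dist_pos.1 hd

lemma measurable_inversion : Measurable (inversion x₀ R : Plane → Plane) := by
  unfold inversion
  simp only [vsub_eq_sub, vadd_eq_add]
  fun_prop

lemma measurable_invDeriv_apply {F : Plane → Plane} (hF : Measurable F) :
    Measurable fun x => invDeriv x₀ R x (F x) := by
  simp only [invDeriv_apply]
  fun_prop

/-- Every trace of a function in `V_R` lies in `H^{1/2}(∂B_R)`. -/
lemma IsOuterTrace.mem_HHalf {D : Set Plane} (hD : IsOpen D) (hR : 0 < R)
    (hBD : closedBall x₀ R ⊆ D) {v : VR D x₀ R} {f : L2Circle x₀ R} (hf : IsOuterTrace v f) :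
    f ∈ HHalf x₀ R := by
  set U := D \ closedBall x₀ R with hU
  have hUm : MeasurableSet U := hD.measurableSet.diff isClosed_closedBall.measurableSet
  have hSW : sphere x₀ R ⊆ D \ {x₀} := fun x hx =>
    ⟨hBD (sphere_subset_closedBall hx), by rintro rfl; simp at hx; linarith⟩
  -- Support in `D` allows `χ v` to be extended by zero to the complement of the closed disc;
  -- avoiding `x₀` keeps the reflected test fields smooth.
  obtain ⟨χ, hχ, hχ1⟩ := exists_isTestFunction_eqOn_one (isCompact_sphere x₀ R)
    (hD.sdiff isClosed_singleton) hSW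
  have hχU : ∀ y ∈ (closedBall x₀ R)ᶜ, y ∉ U → χ y = 0 := fun y hy hyU =>
    hχ.eq_zero fun h => hyU ⟨h.1, hy⟩
  set I : Plane → Plane := inversion x₀ R with hI
  set B' := ball x₀ R \ {x₀} with hB'
  have hB'm : MeasurableSet B' := measurableSet_ball.diff (measurableSet_singleton _)
  have hB'ae : (volume : Measure Plane).restrict (ball x₀ R) = volume.restrict B' := by
    refine Measure.restrict_congr_set ?_
    exact (sdiff_null_ae_eq_self (measure_singleton x₀)).symm
  have hder : ∀ x ∈ B', HasFDerivWithinAt I (invDeriv x₀ R x) B' x := fun x hx =>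
    (hasFDerivAt_inversion' hx.2).hasFDerivWithinAt
  have hinj : InjOn I B' := (inversion_injective x₀ hR.ne').injOn
  have himg : I '' B' = (closedBall x₀ R)ᶜ := image_inversion_ball hR
  -- The gradient of `χ v`. The function on the disc will be `(χ v) ∘ I`, with gradient `DI (G ∘
  -- I)`.
  set G : Plane → Plane := fun y => χ y • v.grad y + v.fn y • gradient χ y with hG
  have hgradc : Continuous (gradient χ) :=
    (LinearIsometryEquiv.continuous _).comp (hχ.smooth.continuous_fderiv (by simp))
  have hgrad0 : ∀ y ∈ (closedBall x₀ R)ᶜ, y ∉ U → gradient χ y = 0 := fun y hy hyU => by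
    have h0 : fderiv ℝ χ y = 0 := image_eq_zero_of_notMem_tsupport
      fun h => hyU ⟨(hχ.supp (tsupport_fderiv_subset ℝ h)).1, hy⟩
    rw [gradient, h0, map_zero]
  have hfnm : Measurable v.fn := (Lp.stronglyMeasurable (v : L2Pair U).fst).measurable
  have hgradm : Measurable v.grad := (Lp.stronglyMeasurable (v : L2Pair U).snd).measurable
  have hχm : Measurable χ := hχ.smooth.continuous.measurable
  have hGm : Measurable G := (hχm.smul hgradm).add (hfnm.smul hgradc.measurable)
  have hχtop : MemLp χ ⊤ (volume.restrict U) :=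
    hχ.smooth.continuous.memLp_of_hasCompactSupport hχ.compact
  have hgradtop : MemLp (gradient χ) ⊤ (volume.restrict U) :=
    hgradc.memLp_of_hasCompactSupport ((hχ.compact.fderiv ℝ).comp_left (map_zero _))
  have h1U : MemLp (fun y => χ y * v.fn y) 2 (volume.restrict U) :=
    v.memLp_fn.mul' (p := ⊤) (q := 2) hχtop
  have hGU : MemLp G 2 (volume.restrict U) :=
    (v.memLp_grad.smul (p := ⊤) (q := 2) hχtop).add (hgradtop.smul (p := 2) (q := ⊤) v.memLp_fn)
  have hext : ∀ g : Plane → ℝ, (∀ y ∈ (closedBall x₀ R)ᶜ, y ∉ U → g y = 0) →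
      IntegrableOn g U → IntegrableOn (fun x => |(invDeriv x₀ R x).det| • g (I x)) B' := by
    intro g hg0 hg
    rw [← integrableOn_image_iff_integrableOn_abs_det_fderiv_smul volume hB'm hder hinj, himg]
    exact hg.of_forall_sdiff_eq_zero isClosed_closedBall.measurableSet.compl
      fun y hy => hg0 y hy.1 hy.2
  -- Inside the disc the Jacobian of the inversion is at least one, so it may be inserted in the
  -- square integral before changing variables.
  have hw : MemLp (fun x => χ (I x) * v.fn (I x)) 2 (volume.restrict (ball x₀ R)) := by
    have hm : Measurable fun x => χ (I x) * v.fn (I x) :=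
      (hχm.mul hfnm).comp measurable_inversion
    rw [memLp_two_iff_integrable_sq hm.aestronglyMeasurable, hB'ae]
    refine (hext (fun y => (χ y * v.fn y) ^ 2) (fun y hy hyU => by rw [hχU y hy hyU]; simp)
      h1U.integrable_sq).mono' (hm.pow_const 2).aestronglyMeasurable ?_
    filter_upwards [ae_restrict_mem hB'm] with x hx
    have hd : 0 < dist x x₀ := dist_pos.2 hx.2
    have hx1 : 1 ≤ (R / dist x x₀) ^ 4 :=
      one_le_pow₀ ((one_le_div hd).2 (mem_ball.1 hx.1).le)
    rw [Real.norm_eq_abs, abs_of_nonneg (sq_nonneg _), abs_det_invDeriv, smul_eq_mul]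
    exact le_mul_of_one_le_left (sq_nonneg _) hx1
  -- Conformal invariance of the Dirichlet integral in the plane: the squared stretching factor of
  -- `DI` is exactly the Jacobian.
  have hGw : MemLp (fun x => invDeriv x₀ R x (G (I x))) 2 (volume.restrict (ball x₀ R)) := by
    have hm : Measurable fun x => invDeriv x₀ R x (G (I x)) :=
      measurable_invDeriv_apply (hGm.comp measurable_inversion)
    rw [memLp_two_iff_integrable_sq_norm hm.aestronglyMeasurable, hB'ae]
    refine (hext (fun y => ‖G y‖ ^ 2) (fun y hy hyU => ?_)
      ((memLp_two_iff_integrable_sq_norm hGU.1).1 hGU)).congr ?_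
    · simp [hG, hχU y hy hyU, hgrad0 y hy hyU]
    · refine Filter.Eventually.of_forall fun x => ?_
      simp only [abs_det_invDeriv, norm_invDeriv_apply, smul_eq_mul]
      ring
  have hgreen : ∀ ψ : Plane → ℝ, IsTestFunction univ ψ → ∀ i : Fin 2,
      ∫ x in ball x₀ R, (χ (I x) * v.fn (I x) * partialDeriv i ψ x
        + invDeriv x₀ R x (G (I x)) i * ψ x)
        = ∫ x, f x * ψ x * (R⁻¹ • (x - x₀)) i ∂(arcLength x₀ R) := by
    intro ψ hψ i
    set g : Plane → ℝ := fun y => ∑ j, (v.fn y * partialDeriv j (reflTest x₀ R χ ψ i j) y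
        + v.grad y j * reflTest x₀ R χ ψ i j y) with hg
    have htest : ∀ j, IsTestFunction D (reflTest x₀ R χ ψ i j) := fun j =>
      (isTestFunction_reflTest hD hχ hψ.smooth i j).mono sdiff_subset
    have h1 : ∫ x in ball x₀ R, (χ (I x) * v.fn (I x) * partialDeriv i ψ x
        + invDeriv x₀ R x (G (I x)) i * ψ x) = ∫ y in (closedBall x₀ R)ᶜ, g y := by
      rw [hB'ae, ← himg, integral_image_eq_integral_abs_det_fderiv_smul volume hB'm hder hinj]
      refine setIntegral_congr_fun hB'm fun x hx => ?_
      exact (reflTest_green hR hχ.differentiable hψ.differentiable i _ _ hx.2).symm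
    have h2 : ∫ y in (closedBall x₀ R)ᶜ, g y = ∫ y in U, g y := by
      refine setIntegral_eq_of_subset_of_forall_sdiff_eq_zero
        isClosed_closedBall.measurableSet.compl (fun y hy => hy.2) fun y hy => ?_
      have hyD : y ∉ D := fun h => hy.2 ⟨h, hy.1⟩
      refine Finset.sum_eq_zero fun j _ => ?_
      rw [(htest j).eq_zero hyD, (htest j).partialDeriv_eq_zero hyD]
      simp
    have h3 : ∀ j, Integrable (fun x => f x * reflTest x₀ R χ ψ i j x * (-(R⁻¹ • (x - x₀))) j)
        (arcLength x₀ R) := fun j => by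
      have h4 : IsTestFunction D fun x => reflTest x₀ R χ ψ i j x * (-(R⁻¹ • (x - x₀))) j :=
        (htest j).mul_contDiff (by
          simp only [PiLp.neg_apply, PiLp.smul_apply]
          exact (contDiff_const.mul (contDiff_coord_sub x₀ j)).neg)
      simpa only [mul_assoc] using integrable_mul_of_L2 (Lp.memLp f) (h4.memLp _)
    rw [h1, h2, integral_finsetSum]
    · rw [Finset.sum_congr rfl fun j _ => hf _ (htest j) j, ← integral_finsetSum _ fun j _ => h3 j]
      refine integral_congr_ae ?_
      -- The inversion fixes the circle and its derivative reverses the normal. This turns the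
      -- normal out of the exterior into the normal out of the disc, so the same `f` is the inner
      -- trace.
      filter_upwards [ae_arcLength_mem_sphere hR] with x hx
      have hIx : I x = x := inversion_of_mem_sphere hx
      have hs := sum_invCoeff_mul_normal hR hx i
      rw [Fin.sum_univ_two] at hs ⊢
      simp only [reflTest, ← hI, hIx, hχ1 x hx, PiLp.neg_apply, PiLp.smul_apply, smul_eq_mul]
      linear_combination -(f x * ψ x * R⁻¹) * hs
    · exact fun j _ => (integrable_mul_of_L2 v.memLp_fn ((htest j).memLp_partialDeriv j _)).add
        (integrable_mul_of_L2 (memLp_coord v.memLp_grad j) ((htest j).memLp _))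
  have hweak : ∀ ψ : Plane → ℝ, IsTestFunction (ball x₀ R) ψ → ∀ i : Fin 2,
      ∫ x in ball x₀ R, (χ (I x) * v.fn (I x) * partialDeriv i ψ x
        + invDeriv x₀ R x (G (I x)) i * ψ x) = 0 := by
    intro ψ hψ i
    rw [hgreen ψ (hψ.mono (subset_univ _)) i]
    refine integral_eq_zero_of_ae ?_
    filter_upwards [ae_arcLength_mem_sphere hR] with x hx
    rw [hψ.eq_zero fun h => (mem_ball.1 h).ne (Metric.mem_sphere.1 hx)]
    simp
  refine ⟨H1.ofFn hw hGw hweak, fun ψ hψ i => ?_⟩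
  rw [← hgreen ψ hψ i]
  refine integral_congr_ae ?_
  filter_upwards [H1.fn_ofFn (h := hweak), H1.grad_ofFn (h := hweak)] with x h1 h2
  rw [h1, h2]

end reflection

lemma memLp_two_add_measure {E : Type*} [NormedAddCommGroup E] {μ ν : Measure Plane}
    {f : Plane → E} (hμ : MemLp f 2 μ) (hν : MemLp f 2 ν) : MemLp f 2 (μ + ν) := by
  have hm : AEStronglyMeasurable f (μ + ν) := hμ.1.add_measure hν.1
  rw [memLp_two_iff_integrable_sq_norm hm]
  exact ((memLp_two_iff_integrable_sq_norm hμ.1).1 hμ).add_measure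
    ((memLp_two_iff_integrable_sq_norm hν.1).1 hν)

/-! ### Restriction -/

lemma H1.fn_restrict {U V : Set Plane} (hVU : V ⊆ U) (u : H1 U) :
    (H1.restrict hVU u).fn =ᵐ[volume.restrict V] u.fn :=
  MemLp.coeFn_toLp (u.memLp_fn.mono_measure (Measure.restrict_mono hVU le_rfl))

lemma H1.grad_restrict {U V : Set Plane} (hVU : V ⊆ U) (u : H1 U) :
    (H1.restrict hVU u).grad =ᵐ[volume.restrict V] u.grad :=
  MemLp.coeFn_toLp (u.memLp_grad.mono_measure (Measure.restrict_mono hVU le_rfl))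

lemma H1.fn_add {U : Set Plane} (u v : H1 U) :
    (u + v).fn =ᵐ[volume.restrict U] fun x => u.fn x + v.fn x :=
  Lp.coeFn_add (u : L2Pair U).fst (v : L2Pair U).fst

lemma H1.grad_add {U : Set Plane} (u v : H1 U) :
    (u + v).grad =ᵐ[volume.restrict U] fun x => u.grad x + v.grad x :=
  Lp.coeFn_add (u : L2Pair U).snd (v : L2Pair U).snd

lemma H1.fn_smul {U : Set Plane} (c : ℝ) (u : H1 U) :
    (c • u).fn =ᵐ[volume.restrict U] fun x => c * u.fn x :=
  Lp.coeFn_smul c (u : L2Pair U).fst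

lemma H1.grad_smul {U : Set Plane} (c : ℝ) (u : H1 U) :
    (c • u).grad =ᵐ[volume.restrict U] fun x => c • u.grad x :=
  Lp.coeFn_smul c (u : L2Pair U).snd

lemma ae_restrict_of_subset {U V : Set Plane} (hVU : V ⊆ U) {p : Plane → Prop}
    (h : ∀ᵐ x ∂(volume.restrict U), p x) : ∀ᵐ x ∂(volume.restrict V), p x :=
  ae_mono (Measure.restrict_mono hVU le_rfl) h

lemma H1.restrict_add {U V : Set Plane} (hVU : V ⊆ U) (u v : H1 U) :
    H1.restrict hVU (u + v) = H1.restrict hVU u + H1.restrict hVU v := by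
  refine H1.ext ?_ ?_
  · filter_upwards [H1.fn_restrict hVU (u + v), H1.fn_restrict hVU u, H1.fn_restrict hVU v,
      H1.fn_add (H1.restrict hVU u) (H1.restrict hVU v),
      ae_restrict_of_subset hVU (H1.fn_add u v)] with x h1 h2 h3 h4 h5
    rw [h1, h4, h5, h2, h3]
  · filter_upwards [H1.grad_restrict hVU (u + v), H1.grad_restrict hVU u, H1.grad_restrict hVU v,
      H1.grad_add (H1.restrict hVU u) (H1.restrict hVU v),
      ae_restrict_of_subset hVU (H1.grad_add u v)] with x h1 h2 h3 h4 h5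
    rw [h1, h4, h5, h2, h3]

lemma H1.restrict_smul {U V : Set Plane} (hVU : V ⊆ U) (c : ℝ) (u : H1 U) :
    H1.restrict hVU (c • u) = c • H1.restrict hVU u := by
  refine H1.ext ?_ ?_
  · filter_upwards [H1.fn_restrict hVU (c • u), H1.fn_restrict hVU u,
      H1.fn_smul c (H1.restrict hVU u),
      ae_restrict_of_subset hVU (H1.fn_smul c u)] with x h1 h2 h4 h5
    rw [h1, h4, h5, h2]
  · filter_upwards [H1.grad_restrict hVU (c • u), H1.grad_restrict hVU u,
      H1.grad_smul c (H1.restrict hVU u),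
      ae_restrict_of_subset hVU (H1.grad_smul c u)] with x h1 h2 h4 h5
    rw [h1, h4, h5, h2]

lemma integrable_gradForm {U : Set Plane} (u v : H1 U) :
    Integrable (fun x => inner ℝ (u.grad x) (v.grad x)) (volume.restrict U) :=
  L2.integrable_inner (𝕜 := ℝ) (u : L2Pair U).snd (v : L2Pair U).snd

lemma integrable_massForm {U : Set Plane} {k : Plane → ℝ} (hk : MemLp k 2 (volume.restrict U))
    (v : H1 U) : Integrable (fun x => k x * v.fn x) (volume.restrict U) :=
  integrable_mul_of_L2 hk v.memLp_fn

lemma gradForm_restrict {U V : Set Plane} (hVU : V ⊆ U) (u v : H1 U) :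
    gradForm (H1.restrict hVU u) (H1.restrict hVU v)
      = ∫ x in V, inner ℝ (u.grad x) (v.grad x) := by
  refine integral_congr_ae ?_
  filter_upwards [H1.grad_restrict hVU u, H1.grad_restrict hVU v] with x h1 h2
  rw [h1, h2]

lemma massForm_restrict {U V : Set Plane} (hVU : V ⊆ U) (k : Plane → ℝ) (v : H1 U) :
    massForm k (H1.restrict hVU v) = ∫ x in V, k x * v.fn x := by
  refine integral_congr_ae ?_
  filter_upwards [H1.fn_restrict hVU v] with x h1
  rw [h1]

lemma massForm_fn_restrict {U V : Set Plane} (hVU : V ⊆ U) (u v : H1 U) :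
    massForm (H1.restrict hVU u).fn (H1.restrict hVU v) = ∫ x in V, u.fn x * v.fn x := by
  rw [massForm_congr (H1.fn_restrict hVU u), massForm_restrict]

lemma H1.norm_restrict_le {U V : Set Plane} (hVU : V ⊆ U) (u : H1 U) :
    ‖H1.restrict hVU u‖ ≤ ‖u‖ := by
  refine le_of_sq_le_sq ?_ (norm_nonneg u)
  rw [H1.norm_sq, H1.norm_sq, gradForm_restrict, massForm_fn_restrict]
  refine add_le_add ?_ ?_
  · exact setIntegral_mono_set (integrable_massForm u.memLp_fn u)
      (Filter.Eventually.of_forall fun x => mul_self_nonneg _) hVU.eventuallyLE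
  · exact setIntegral_mono_set (integrable_gradForm u u)
      (Filter.Eventually.of_forall fun x => real_inner_self_nonneg) hVU.eventuallyLE

/-- Restriction as a continuous linear map. -/
def H1.restrictL {U V : Set Plane} (hVU : V ⊆ U) : H1 U →L[ℝ] H1 V :=
  LinearMap.mkContinuous
    { toFun := H1.restrict hVU
      map_add' := H1.restrict_add hVU
      map_smul' := H1.restrict_smul hVU } 1 fun u => by
    rw [one_mul]; exact H1.norm_restrict_le hVU u

/-! ### Gluing across the circle -/

section glue

variable {D : Set Plane} {x₀ : Plane} {R : ℝ}

lemma outerTrace_eq (hD : IsOpen D) (hR : 0 < R) (hBD : closedBall x₀ R ⊆ D) {v : VR D x₀ R}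
    {f : L2Circle x₀ R} (hf : IsOuterTrace v f) : outerTrace v = f :=
  isOuterTrace_unique hD hR hBD (Classical.epsilon_spec (p := IsOuterTrace v) ⟨f, hf⟩) hf

lemma isOuterTrace_outerTrace (hD : IsOpen D) (hDfin : volume D ≠ ⊤) (hR : 0 < R)
    (hBD : closedBall x₀ R ⊆ D) (v : VR D x₀ R) : IsOuterTrace v (outerTrace v) :=
  Classical.epsilon_spec (p := IsOuterTrace v) (exists_isOuterTrace hD hDfin hR hBD v)

lemma outerTrace_mem_HHalf (hD : IsOpen D) (hDfin : volume D ≠ ⊤) (hR : 0 < R)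
    (hBD : closedBall x₀ R ⊆ D) (v : VR D x₀ R) : outerTrace v ∈ HHalf x₀ R :=
  (isOuterTrace_outerTrace hD hDfin hR hBD v).mem_HHalf hD hR hBD

lemma isOuterTrace_zero : IsOuterTrace (0 : VR D x₀ R) 0 := by
  intro ψ hψ i
  rw [← greenL_apply hψ]
  have : ∫ x, (0 : L2Circle x₀ R) x * ψ x * (-(R⁻¹ • (x - x₀))) i ∂(arcLength x₀ R) = 0 := by
    refine integral_eq_zero_of_ae ?_
    filter_upwards [Lp.coeFn_zero ℝ 2 (arcLength x₀ R)] with x hx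
    rw [hx]
    simp
  rw [this]
  exact map_zero _

/-- The circle itself is a null set, so the open disc and the exterior of the closed disc exhaust
`D`. -/
lemma restrict_eq_add (hD : IsOpen D) (hBD : closedBall x₀ R ⊆ D) :
    (volume : Measure Plane).restrict D
      = volume.restrict (ball x₀ R) + volume.restrict (D \ closedBall x₀ R) := by
  have h1 : (volume : Measure Plane).restrict (ball x₀ R) = volume.restrict (closedBall x₀ R) :=
    Measure.restrict_congr_set (Filter.EventuallyEq.symm (by
      rw [← ball_union_sphere]
      exact union_ae_eq_left_of_ae_eq_empty (by
        rw [ae_eq_empty]; exact Measure.addHaar_sphere _ _ _)))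
  rw [h1, ← Measure.restrict_union disjoint_sdiff_right
    (hD.measurableSet.diff isClosed_closedBall.measurableSet), union_sdiff_cancel hBD]

lemma setIntegral_split (hD : IsOpen D) (hBD : closedBall x₀ R ⊆ D) {f : Plane → ℝ}
    (hf : Integrable f (volume.restrict D)) :
    ∫ x in D, f x = (∫ x in ball x₀ R, f x) + ∫ x in D \ closedBall x₀ R, f x := by
  rw [restrict_eq_add hD hBD] at hf ⊢
  exact integral_add_measure (hf.mono_measure (Measure.le_add_right le_rfl))
    (hf.mono_measure (Measure.le_add_left le_rfl))

lemma ball_subset_of (hBD : closedBall x₀ R ⊆ D) : ball x₀ R ⊆ D :=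
  ball_subset_closedBall.trans hBD

lemma outer_subset : D \ closedBall x₀ R ⊆ D := sdiff_subset

lemma integrable_green {U W : Set Plane} {ψ : Plane → ℝ} (hψ : IsTestFunction W ψ) (i : Fin 2)
    (u : H1 U) : Integrable (fun x => u.fn x * partialDeriv i ψ x + u.grad x i * ψ x)
      (volume.restrict U) :=
  (integrable_mul_of_L2 u.memLp_fn (hψ.memLp_partialDeriv i _)).add
    (integrable_mul_of_L2 (memLp_coord u.memLp_grad i) (hψ.memLp _))

lemma green_eq_zero {U : Set Plane} {ψ : Plane → ℝ} (hψ : IsTestFunction U ψ) (i : Fin 2)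
    (u : H1 U) : ∫ x in U, (u.fn x * partialDeriv i ψ x + u.grad x i * ψ x) = 0 :=
  (hasWeakGradient_iff u.memLp_fn u.memLp_grad).1 u.2 ψ hψ i

lemma green_restrict {U V W : Set Plane} (hVU : V ⊆ U) {ψ : Plane → ℝ}
    (_hψ : IsTestFunction W ψ) (i : Fin 2) (u : H1 U) :
    ∫ x in V, ((H1.restrict hVU u).fn x * partialDeriv i ψ x + (H1.restrict hVU u).grad x i * ψ x)
      = ∫ x in V, (u.fn x * partialDeriv i ψ x + u.grad x i * ψ x) := by
  refine integral_congr_ae ?_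
  filter_upwards [H1.fn_restrict hVU u, H1.grad_restrict hVU u] with x h1 h2
  rw [h1, h2]

/-- The traces from both sides of a function in `H¹(D)` agree. -/
lemma isInnerTrace_restrict (hD : IsOpen D) (hDfin : volume D ≠ ⊤) (hR : 0 < R)
    (hBD : closedBall x₀ R ⊆ D) (u : H1 D) :
    IsInnerTrace (H1.restrict (ball_subset_of hBD) u)
      (outerTrace (H1.restrict (outer_subset (x₀ := x₀) (R := R)) u)) := by
  intro ψ hψ i
  set f := outerTrace (H1.restrict (outer_subset (x₀ := x₀) (R := R)) u)
  have hf : IsOuterTrace (H1.restrict (outer_subset (x₀ := x₀) (R := R)) u) f :=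
    isOuterTrace_outerTrace hD hDfin hR hBD _
  -- An inner trace is tested by functions on the whole plane, an outer trace only by functions
  -- supported in `D`. Multiplying by `χ` makes `ψ` admissible without changing it on the closed
  -- disc.
  obtain ⟨χ, hχ, hχ1⟩ := exists_isTestFunction_eqOn_one (isCompact_closedBall x₀ R) hD hBD
  have hη : IsTestFunction D (fun x => χ x * ψ x) := hχ.mul_contDiff hψ.smooth
  have h1 := green_eq_zero hη i u
  rw [setIntegral_split hD hBD (integrable_green hη i u), ← green_restrict outer_subset hη,
    hf _ hη i] at h1
  have h2 : ∫ x in ball x₀ R, (u.fn x * partialDeriv i (fun x => χ x * ψ x) x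
      + u.grad x i * (χ x * ψ x)) = ∫ x in ball x₀ R, (u.fn x * partialDeriv i ψ x
      + u.grad x i * ψ x) := by
    refine setIntegral_congr_fun measurableSet_ball fun x hx => ?_
    have e1 : (fun x => χ x * ψ x) =ᶠ[nhds x] ψ := by
      filter_upwards [isOpen_ball.mem_nhds hx] with y hy
      rw [hχ1 y (ball_subset_closedBall hy), one_mul]
    simp only [partialDeriv, e1.fderiv_eq, hχ1 x (ball_subset_closedBall hx), one_mul]
  rw [green_restrict _ hψ, ← h2, eq_neg_of_add_eq_zero_left h1, ← integral_neg]
  refine integral_congr_ae ?_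
  filter_upwards [ae_arcLength_mem_sphere hR] with x hx
  rw [hχ1 x (sphere_subset_closedBall hx)]
  simp only [PiLp.neg_apply]
  ring

/-- Functions on both sides of the circle with the same trace can be glued. -/
lemma exists_glue (hD : IsOpen D) (hDfin : volume D ≠ ⊤) (hR : 0 < R)
    (hBD : closedBall x₀ R ⊆ D) {w : H1 (ball x₀ R)} {v : VR D x₀ R}
    (hw : IsInnerTrace w (outerTrace v)) :
    ∃ u : H1 D, H1.restrict (ball_subset_of hBD) u = w ∧ H1.restrict outer_subset u = v := by
  classical
  have hBm : MeasurableSet (ball x₀ R) := measurableSet_ball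
  have hUm : MeasurableSet (D \ closedBall x₀ R) := hD.measurableSet.diff isClosed_closedBall.measurableSet
  have hUB : ∀ x ∈ (D \ closedBall x₀ R), x ∉ (ball x₀ R) := fun x hx hxB => hx.2 (ball_subset_closedBall hxB)
  set F : Plane → ℝ := fun x => if x ∈ (ball x₀ R) then w.fn x else v.fn x
  set G : Plane → Plane := fun x => if x ∈ (ball x₀ R) then w.grad x else v.grad x
  have hFB : ∀ᵐ x ∂(volume.restrict (ball x₀ R)), F x = w.fn x :=
    (ae_restrict_mem hBm).mono fun x hx => if_pos hx
  have hGB : ∀ᵐ x ∂(volume.restrict (ball x₀ R)), G x = w.grad x :=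
    (ae_restrict_mem hBm).mono fun x hx => if_pos hx
  have hFU : ∀ᵐ x ∂(volume.restrict (D \ closedBall x₀ R)), F x = v.fn x :=
    (ae_restrict_mem hUm).mono fun x hx => if_neg (hUB x hx)
  have hGU : ∀ᵐ x ∂(volume.restrict (D \ closedBall x₀ R)), G x = v.grad x :=
    (ae_restrict_mem hUm).mono fun x hx => if_neg (hUB x hx)
  have hF : MemLp F 2 (volume.restrict D) := by
    rw [restrict_eq_add hD hBD]
    exact memLp_two_add_measure (w.memLp_fn.ae_eq (hFB.mono fun _ h => h.symm))
      (v.memLp_fn.ae_eq (hFU.mono fun _ h => h.symm))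
  have hG : MemLp G 2 (volume.restrict D) := by
    rw [restrict_eq_add hD hBD]
    exact memLp_two_add_measure (w.memLp_grad.ae_eq (hGB.mono fun _ h => h.symm))
      (v.memLp_grad.ae_eq (hGU.mono fun _ h => h.symm))
  have hweak : ∀ ψ : Plane → ℝ, IsTestFunction D ψ → ∀ i : Fin 2,
      ∫ x in D, (F x * partialDeriv i ψ x + G x i * ψ x) = 0 := by
    intro ψ hψ i
    have hint : Integrable (fun x => F x * partialDeriv i ψ x + G x i * ψ x)
        (volume.restrict D) := (integrable_mul_of_L2 hF (hψ.memLp_partialDeriv i _)).add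
      (integrable_mul_of_L2 (memLp_coord hG i) (hψ.memLp _))
    rw [setIntegral_split hD hBD hint]
    have e1 : ∫ x in (ball x₀ R), (F x * partialDeriv i ψ x + G x i * ψ x)
        = ∫ x in (ball x₀ R), (w.fn x * partialDeriv i ψ x + w.grad x i * ψ x) := by
      refine integral_congr_ae ?_
      filter_upwards [hFB, hGB] with x h1 h2
      rw [h1, h2]
    have e2 : ∫ x in (D \ closedBall x₀ R), (F x * partialDeriv i ψ x + G x i * ψ x)
        = ∫ x in (D \ closedBall x₀ R), (v.fn x * partialDeriv i ψ x + v.grad x i * ψ x) := by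
      refine integral_congr_ae ?_
      filter_upwards [hFU, hGU] with x h1 h2
      rw [h1, h2]
    rw [e1, e2, hw ψ (hψ.mono (subset_univ _)) i,
      isOuterTrace_outerTrace hD hDfin hR hBD v ψ hψ i]
    -- The two boundary integrals have the same density and opposite normals, so they cancel and no
    -- distributional jump is left on the circle.
    simp only [PiLp.neg_apply, mul_neg]
    rw [integral_neg, add_neg_cancel]
  refine ⟨H1.ofFn hF hG hweak, H1.ext ?_ ?_, H1.ext ?_ ?_⟩
  · filter_upwards [H1.fn_restrict (ball_subset_of hBD) (H1.ofFn hF hG hweak),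
      ae_restrict_of_subset (ball_subset_of hBD) (H1.fn_ofFn (h := hweak)), hFB] with x h1 h2 h3
    rw [h1, h2, h3]
  · filter_upwards [H1.grad_restrict (ball_subset_of hBD) (H1.ofFn hF hG hweak),
      ae_restrict_of_subset (ball_subset_of hBD) (H1.grad_ofFn (h := hweak)), hGB] with x h1 h2 h3
    rw [h1, h2, h3]
  · filter_upwards [H1.fn_restrict outer_subset (H1.ofFn hF hG hweak),
      ae_restrict_of_subset outer_subset (H1.fn_ofFn (h := hweak)), hFU] with x h1 h2 h3
    rw [h1, h2, h3]
  · filter_upwards [H1.grad_restrict outer_subset (H1.ofFn hF hG hweak),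
      ae_restrict_of_subset outer_subset (H1.grad_ofFn (h := hweak)), hGU] with x h1 h2 h3
    rw [h1, h2, h3]

/-- Only the hole has to be filled, and the trace of `v` has an `H¹` lift in the disc; the boundary
of `D` plays no role. -/
lemma exists_lift (hD : IsOpen D) (hDfin : volume D ≠ ⊤) (hR : 0 < R)
    (hBD : closedBall x₀ R ⊆ D) (v : VR D x₀ R) :
    ∃ u : H1 D, H1.restrict outer_subset u = v := by
  obtain ⟨w, hw⟩ := outerTrace_mem_HHalf hD hDfin hR hBD v
  obtain ⟨u, -, hu⟩ := exists_glue hD hDfin hR hBD hw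
  exact ⟨u, hu⟩

lemma exists_extend_zero (hD : IsOpen D) (hDfin : volume D ≠ ⊤) (hR : 0 < R)
    (hBD : closedBall x₀ R ⊆ D) {η : H1 (ball x₀ R)} (hη : IsInnerTrace η 0) :
    ∃ u : H1 D, H1.restrict (ball_subset_of hBD) u = η ∧
      H1.restrict (outer_subset (x₀ := x₀) (R := R)) u = 0 := by
  refine exists_glue hD hDfin hR hBD ?_
  rwa [outerTrace_eq hD hR hBD isOuterTrace_zero]

lemma massForm_split (hD : IsOpen D) (hBD : closedBall x₀ R ⊆ D) {k : Plane → ℝ}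
    (hk : MemLp k 2 (volume.restrict D)) (φ : H1 D) :
    massForm k φ = massForm k (H1.restrict (ball_subset_of hBD) φ)
      + massForm k (H1.restrict (outer_subset (x₀ := x₀) (R := R)) φ) := by
  rw [massForm_restrict, massForm_restrict]
  exact setIntegral_split hD hBD (integrable_massForm hk φ)

lemma energyL_split (hD : IsOpen D) (hBD : closedBall x₀ R ⊆ D) (α : ℝ) (u φ : H1 D) :
    energyL α D u φ
      = energyL α _ (H1.restrict (ball_subset_of hBD) u) (H1.restrict (ball_subset_of hBD) φ)
      + energyL α _ (H1.restrict (outer_subset (x₀ := x₀) (R := R)) u)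
        (H1.restrict outer_subset φ) := by
  have h1 := setIntegral_split hD hBD (integrable_massForm u.memLp_fn φ)
  have h2 := setIntegral_split hD hBD (integrable_gradForm u φ)
  rw [energyL_apply, energyL_apply, energyL_apply, massForm_fn_restrict, massForm_fn_restrict,
    gradForm_restrict, gradForm_restrict]
  simp only [gradForm, massForm] at *
  rw [h1, h2]
  ring

end glue

/-! ### The truncated problem and the problem on the whole domain -/

section truncated

variable {D : Set Plane} {x₀ : Plane} {R : ℝ} {α : ℝ}

lemma interiorSol_spec (hα : 0 < α) {k : Plane → ℝ}
    (hk : MemLp k 2 (volume.restrict (ball x₀ R))) {φ : L2Circle x₀ R} (hφ : φ ∈ HHalf x₀ R) :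
    IsDirichletSolution α k φ (interiorSol α k φ) :=
  Classical.epsilon_spec (p := IsDirichletSolution α k φ)
    (existsUnique_isDirichletSolution hα hk hφ).exists

lemma IsDirichletSolution.unique (hα : 0 < α) {k : Plane → ℝ}
    (hk : MemLp k 2 (volume.restrict (ball x₀ R))) {φ : L2Circle x₀ R} {u v : H1 (ball x₀ R)}
    (hu : IsDirichletSolution α k φ u) (hv : IsDirichletSolution α k φ v) : u = v :=
  (existsUnique_isDirichletSolution hα hk ⟨u, hu.trace⟩).unique hu hv

lemma zero_mem_HHalf : (0 : L2Circle x₀ R) ∈ HHalf x₀ R := ⟨0, (H10 x₀ R).zero_mem⟩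

lemma memLp_zero_source {μ : Measure Plane} : MemLp (0 : Plane → ℝ) 2 μ := MemLp.zero

lemma IsDirichletSolution.add_zero {k : Plane → ℝ} {φ : L2Circle x₀ R}
    {u v : H1 (ball x₀ R)} (hu : IsDirichletSolution α 0 φ u)
    (hv : IsDirichletSolution α k 0 v) : IsDirichletSolution α k φ (u + v) where
  trace := hu.trace.add_zero hv.trace
  weak := fun η hη => by
    rw [← energyL_apply, energyL_add_left, hu.energy hη, hv.energy hη, massForm_zero, zero_add]

/-- Green's formula for the normal derivative. -/
lemma IsDirichletSolution.energy_eq_normalDeriv (hα : 0 < α) {k : Plane → ℝ}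
    (hk : MemLp k 2 (volume.restrict (ball x₀ R))) {φ ψ : L2Circle x₀ R} {u Ψ : H1 (ball x₀ R)}
    (hu : IsDirichletSolution α k φ u) (hΨ : IsInnerTrace Ψ ψ) :
    energyL α (ball x₀ R) u Ψ = α * normalDeriv α k u ψ + massForm k Ψ := by
  rw [normalDeriv_eq hα.ne' hk hu hΨ, energyL_apply]
  field_simp
  ring

/-- By superposition `u` is the homogeneous solution with boundary value `φ` plus the solution with
source `k` and zero boundary value. The first contributes `T₀`, the second `h₀`. -/
lemma IsDirichletSolution.energy_eq_dtn (hα : 0 < α) {k : Plane → ℝ}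
    (hk : MemLp k 2 (volume.restrict (ball x₀ R))) {φ ψ : L2Circle x₀ R} {u Ψ : H1 (ball x₀ R)}
    (hu : IsDirichletSolution α k φ u) (hΨ : IsInnerTrace Ψ ψ) :
    energyL α (ball x₀ R) u Ψ = α * dtn α φ ψ - α * boundaryDatum α k ψ + massForm k Ψ := by
  have hy := interiorSol_spec hα memLp_zero_source (⟨u, hu.trace⟩ : φ ∈ HHalf x₀ R)
  have hz := interiorSol_spec hα hk (zero_mem_HHalf (x₀ := x₀) (R := R))
  rw [hu.unique hα hk (hy.add_zero hz), energyL_add_left,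
    hy.energy_eq_normalDeriv hα memLp_zero_source hΨ, hz.energy_eq_normalDeriv hα hk hΨ,
    massForm_zero, dtn, boundaryDatum]
  ring

/-- Reciprocity between the boundary datum and the homogeneous interior problem. -/
lemma boundaryDatum_eq (hα : 0 < α) {k : Plane → ℝ}
    (hk : MemLp k 2 (volume.restrict (ball x₀ R))) {ψ : L2Circle x₀ R} {y : H1 (ball x₀ R)}
    (hy : IsDirichletSolution α 0 ψ y) : α * boundaryDatum α k ψ = massForm k y := by
  have hz := interiorSol_spec hα hk (zero_mem_HHalf (x₀ := x₀) (R := R))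
  have h1 := hz.energy_eq_normalDeriv hα hk hy.trace
  -- The source solution `z` has zero trace, hence is a test function in the homogeneous equation
  -- for `y`; symmetry of the energy does the rest.
  have h2 := hy.energy hz.trace
  rw [massForm_zero, energyL_symm] at h2
  rw [boundaryDatum]
  linarith

lemma energyL_zero_right {U : Set Plane} (u : H1 U) : energyL α U u 0 = 0 :=
  (energyL α U u).map_zero

lemma massForm_zero_right {U : Set Plane} {k : Plane → ℝ} (hk : MemLp k 2 (volume.restrict U)) :
    massForm k (0 : H1 U) = 0 := by
  rw [← massL_apply hk]
  exact (massL hk).map_zero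

lemma energyL_split_of (hD : IsOpen D) (hBD : closedBall x₀ R ⊆ D) (α : ℝ) {u φ : H1 D}
    {uB φB : H1 (ball x₀ R)} {uV φV : VR D x₀ R}
    (h1 : H1.restrict (ball_subset_of hBD) u = uB) (h2 : H1.restrict outer_subset u = uV)
    (h3 : H1.restrict (ball_subset_of hBD) φ = φB) (h4 : H1.restrict outer_subset φ = φV) :
    energyL α D u φ = energyL α _ uB φB + energyL α _ uV φV := by
  subst h1 h2 h3 h4
  exact energyL_split hD hBD α u φ

lemma massForm_split_of (hD : IsOpen D) (hBD : closedBall x₀ R ⊆ D) {k : Plane → ℝ}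
    (hk : MemLp k 2 (volume.restrict D)) {φ : H1 D} {φB : H1 (ball x₀ R)} {φV : VR D x₀ R}
    (h3 : H1.restrict (ball_subset_of hBD) φ = φB) (h4 : H1.restrict outer_subset φ = φV) :
    massForm k φ = massForm k φB + massForm k φV := by
  subst h3 h4
  exact massForm_split hD hBD hk φ

lemma a₀_eq (v φ : VR D x₀ R) :
    a₀ α v φ = energyL α _ v φ + α * dtn α (outerTrace v) (outerTrace φ) := by
  rw [a₀, energyL_apply]
  ring

lemma MemLp.restrict_ball (hBD : closedBall x₀ R ⊆ D) {k : Plane → ℝ}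
    (hk : MemLp k 2 (volume.restrict D)) : MemLp k 2 (volume.restrict (ball x₀ R)) :=
  hk.mono_measure (Measure.restrict_mono (ball_subset_of hBD) le_rfl)

/-- If `u` solves the interior problem, its energy on `D` is the truncated form. -/
lemma energyL_eq_a₀ (hD : IsOpen D) (hDfin : volume D ≠ ⊤) (hα : 0 < α) (hR : 0 < R)
    (hBD : closedBall x₀ R ⊆ D) {k : Plane → ℝ} (hk : MemLp k 2 (volume.restrict D)) {u : H1 D}
    (hu : IsDirichletSolution α k (outerTrace (H1.restrict (outer_subset (x₀ := x₀) (R := R)) u))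
      (H1.restrict (ball_subset_of hBD) u)) (φ : H1 D) :
    energyL α D u φ - massForm k φ
      = a₀ α (H1.restrict (outer_subset (x₀ := x₀) (R := R)) u) (H1.restrict outer_subset φ)
        - l₀ α k (H1.restrict (outer_subset (x₀ := x₀) (R := R)) φ) := by
  have h1 := energyL_split (x₀ := x₀) (R := R) hD hBD α u φ
  have h2 := massForm_split (x₀ := x₀) (R := R) hD hBD hk φ
  have h3 := hu.energy_eq_dtn hα (MemLp.restrict_ball hBD hk)
    (isInnerTrace_restrict hD hDfin hR hBD φ)
  rw [a₀_eq, l₀]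
  linarith

/-- A test function in the disc with zero trace extends by zero to `H¹(D)` and may be used in the
Neumann problem. -/
lemma IsNeumannSolution.isDirichletSolution_restrict (hD : IsOpen D) (hDfin : volume D ≠ ⊤)
    (hR : 0 < R) (hBD : closedBall x₀ R ⊆ D) {k : Plane → ℝ}
    (hk : MemLp k 2 (volume.restrict D)) {u : H1 D} (hu : IsNeumannSolution α D k u) :
    IsDirichletSolution α k (outerTrace (H1.restrict (outer_subset (x₀ := x₀) (R := R)) u))
      (H1.restrict (ball_subset_of hBD) u) where
  trace := isInnerTrace_restrict hD hDfin hR hBD u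
  weak := fun η hη => by
    obtain ⟨φ, hφ, hφ0⟩ := exists_extend_zero hD hDfin hR hBD hη
    have h1 := energyL_split_of (u := u) hD hBD α rfl rfl hφ hφ0
    have h2 := massForm_split_of hD hBD hk hφ hφ0
    have h3 := hu φ
    have h4 := energyL_zero_right (α := α)
      (H1.restrict (outer_subset (x₀ := x₀) (R := R)) u)
    have h5 := massForm_zero_right (U := D \ closedBall x₀ R)
      (hk.mono_measure (Measure.restrict_mono outer_subset le_rfl))
    rw [h4, energyL_apply, energyL_apply, h3, h2, h5, _root_.add_zero, _root_.add_zero] at h1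
    exact h1.symm

/-- Solutions of the truncated problem are the restrictions of solutions on the whole domain. -/
theorem isExteriorSolution_iff (hD : IsOpen D) (hDfin : volume D ≠ ⊤) (hα : 0 < α) (hR : 0 < R)
    (hBD : closedBall x₀ R ⊆ D) {k : Plane → ℝ} (hk : MemLp k 2 (volume.restrict D))
    (w : VR D x₀ R) : IsExteriorSolution α k w ↔
      ∃ u : H1 D, IsNeumannSolution α D k u ∧ H1.restrict outer_subset u = w := by
  constructor
  · intro hw
    have hs := interiorSol_spec hα (MemLp.restrict_ball hBD hk)
      (outerTrace_mem_HHalf hD hDfin hR hBD w)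
    obtain ⟨u, hu, huw⟩ := exists_glue hD hDfin hR hBD hs.trace
    refine ⟨u, fun φ => ?_, huw⟩
    have h1 := energyL_eq_a₀ hD hDfin hα hR hBD hk (u := u) (by rw [hu, huw]; exact hs) φ
    rw [huw, hw, sub_self, energyL_apply] at h1
    linarith
  · rintro ⟨u, hu, rfl⟩ φ
    -- The value of the residual depends only on the restriction of the test function, so any lift
    -- will do.
    obtain ⟨Φ, rfl⟩ := exists_lift hD hDfin hR hBD φ
    have h1 := energyL_eq_a₀ hD hDfin hα hR hBD hk
      (hu.isDirichletSolution_restrict hD hDfin hR hBD hk) Φ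
    rw [energyL_apply, hu Φ, sub_self] at h1
    linarith

theorem existsUnique_isExteriorSolution (hD : IsOpen D) (hDfin : volume D ≠ ⊤) (hα : 0 < α)
    (hR : 0 < R) (hBD : closedBall x₀ R ⊆ D) {k : Plane → ℝ}
    (hk : MemLp k 2 (volume.restrict D)) : ∃! w : VR D x₀ R, IsExteriorSolution α k w := by
  obtain ⟨u, hu, huniq⟩ := existsUnique_isNeumannSolution hα hk
  refine ⟨H1.restrict outer_subset u,
    (isExteriorSolution_iff hD hDfin hα hR hBD hk _).2 ⟨u, hu, rfl⟩, fun w hw => ?_⟩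
  obtain ⟨u', hu', rfl⟩ := (isExteriorSolution_iff hD hDfin hα hR hBD hk _).1 hw
  rw [huniq u' hu']

/-! ### The extension operator -/

/-- The functions in `H¹(D)` that solve the homogeneous equation in `B_R`. -/
def homogeneousInBall (α : ℝ) (hBD : closedBall x₀ R ⊆ D) : Submodule ℝ (H1 D) where
  carrier := {u | ∀ η ∈ H10 x₀ R, energyL α _ (H1.restrictL (ball_subset_of hBD) u) η = 0}
  zero_mem' := fun η _ => by
    rw [map_zero, map_zero]; rfl
  add_mem' := fun {u v} hu hv η hη => by
    rw [map_add, energyL_add_left, hu η hη, hv η hη, _root_.add_zero]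
  smul_mem' := fun c u hu η hη => by
    rw [map_smul, map_smul]
    exact (congrArg (c * ·) (hu η hη)).trans (mul_zero c)

lemma isClosed_homogeneousInBall (hBD : closedBall x₀ R ⊆ D) :
    IsClosed (homogeneousInBall α hBD : Set (H1 D)) := by
  have : (homogeneousInBall α hBD : Set (H1 D)) = ⋂ (η : H1 (ball x₀ R)) (_ : η ∈ H10 x₀ R),
      {u | energyL α _ (H1.restrictL (ball_subset_of hBD) u) η = 0} := by
    ext u
    simp only [mem_iInter, mem_ofPred_eq]
    rfl
  rw [this]
  refine isClosed_iInter fun η => isClosed_iInter fun _ => isClosed_eq ?_ continuous_const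
  exact ((energyL α (ball x₀ R)).flip η).continuous.comp (ContinuousLinearMap.continuous _)

lemma isDirichletSolution_of_mem_homogeneousInBall (hD : IsOpen D) (hDfin : volume D ≠ ⊤)
    (hR : 0 < R) (hBD : closedBall x₀ R ⊆ D) {u : H1 D} (hu : u ∈ homogeneousInBall α hBD) :
    IsDirichletSolution α 0 (outerTrace (H1.restrict (outer_subset (x₀ := x₀) (R := R)) u))
      (H1.restrict (ball_subset_of hBD) u) where
  trace := isInnerTrace_restrict hD hDfin hR hBD u
  weak := fun η hη => by
    rw [← energyL_apply, massForm_zero]; exact hu η hη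

/-- Such a `u` has zero trace, so inside the disc it may test its own homogeneous equation; its
energy vanishes. -/
lemma eq_zero_of_mem_homogeneousInBall (hD : IsOpen D) (hDfin : volume D ≠ ⊤) (hα : 0 < α)
    (hR : 0 < R) (hBD : closedBall x₀ R ⊆ D) {u : H1 D} (hu : u ∈ homogeneousInBall α hBD)
    (hu0 : H1.restrict (outer_subset (x₀ := x₀) (R := R)) u = 0) : u = 0 := by
  have h1 := isDirichletSolution_of_mem_homogeneousInBall hD hDfin hR hBD hu
  rw [hu0, outerTrace_eq hD hR hBD isOuterTrace_zero] at h1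
  have h2 : energyL α D u u = 0 := by
    have h3 := energyL_split_of hD hBD α rfl hu0 rfl hu0
    have h4 := h1.energy h1.trace
    rw [massForm_zero] at h4
    rw [h3, h4, energyL_zero_right, _root_.add_zero]
  have h3 := energyL_coercive α u
  rw [h2, mul_assoc] at h3
  by_contra hne
  exact absurd h3 (not_le.2 (mul_pos (lt_min hα one_pos)
    (mul_pos (norm_pos_iff.2 hne) (norm_pos_iff.2 hne))))

lemma exists_mem_homogeneousInBall (hD : IsOpen D) (hDfin : volume D ≠ ⊤) (hα : 0 < α)
    (hR : 0 < R) (hBD : closedBall x₀ R ⊆ D) (v : VR D x₀ R) :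
    ∃ u ∈ homogeneousInBall α hBD, H1.restrictL outer_subset u = v := by
  have hs := interiorSol_spec hα memLp_zero_source (outerTrace_mem_HHalf hD hDfin hR hBD v)
  obtain ⟨u, hu, huv⟩ := exists_glue hD hDfin hR hBD hs.trace
  refine ⟨u, fun η hη => ?_, huv⟩
  have h1 := (hs.energy (mem_H10.1 hη)).trans (massForm_zero η)
  rw [← hu] at h1
  exact h1

/-- A bounded operator that is bijective from a closed subspace has a bounded inverse there. -/
lemma exists_inverse_on_closed {X Y : Type*} [NormedAddCommGroup X] [NormedSpace ℝ X]
    [CompleteSpace X] [NormedAddCommGroup Y] [NormedSpace ℝ Y] [CompleteSpace Y] (T : X →L[ℝ] Y)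
    (K : Submodule ℝ X) (hK : IsClosed (K : Set X)) (hinj : ∀ u ∈ K, T u = 0 → u = 0)
    (hsurj : ∀ v, ∃ u ∈ K, T u = v) : ∃ E : Y →L[ℝ] X, ∀ v, E v ∈ K ∧ T (E v) = v := by
  have : CompleteSpace K := hK.completeSpace_coe
  let S : K →L[ℝ] Y := T.comp K.subtypeL
  have h1 : S.ker = ⊥ := LinearMap.ker_eq_bot'.2 fun u hu => Subtype.ext (hinj u u.2 hu)
  have h2 : S.range = ⊤ := LinearMap.range_eq_top.2 fun v => by
    obtain ⟨u, hu, huv⟩ := hsurj v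
    exact ⟨⟨u, hu⟩, huv⟩
  let e := ContinuousLinearEquiv.ofBijective S h1 h2
  exact ⟨K.subtypeL.comp (e.symm : Y →L[ℝ] K), fun v =>
    ⟨(e.symm v).2, e.apply_symm_apply v⟩⟩

/-- Extension to `D` by the homogeneous interior problem is a bounded operator. -/
theorem exists_extensionOperator (hD : IsOpen D) (hDfin : volume D ≠ ⊤) (hα : 0 < α) (hR : 0 < R)
    (hBD : closedBall x₀ R ⊆ D) : ∃ E : VR D x₀ R →L[ℝ] H1 D, ∀ v,
      H1.restrict outer_subset (E v) = v ∧
      IsDirichletSolution α 0 (outerTrace v) (H1.restrict (ball_subset_of hBD) (E v)) := by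
  -- Restriction is bijective from the closed subspace of interior solutions onto `V_R`, so
  -- boundedness of `E` comes from the bounded inverse theorem and no trace estimate is required.
  obtain ⟨E, hE⟩ := exists_inverse_on_closed (H1.restrictL (outer_subset (x₀ := x₀) (R := R)))
    (homogeneousInBall α hBD) (isClosed_homogeneousInBall hBD)
    (fun u hu h0 => eq_zero_of_mem_homogeneousInBall hD hDfin hα hR hBD hu h0)
    (exists_mem_homogeneousInBall hD hDfin hα hR hBD)
  refine ⟨E, fun v => ⟨(hE v).2, ?_⟩⟩
  have h1 : H1.restrict outer_subset (E v) = v := (hE v).2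
  have h2 := isDirichletSolution_of_mem_homogeneousInBall hD hDfin hR hBD (hE v).1
  rwa [h1] at h2

/-- Both sides of the adjoint problem: the load of the truncated problem is the load on the whole
domain of the extension. -/
lemma l₀_eq_massForm (hD : IsOpen D) (hα : 0 < α) (hBD : closedBall x₀ R ⊆ D) {k : Plane → ℝ}
    (hk : MemLp k 2 (volume.restrict D)) {v : VR D x₀ R} {u : H1 D}
    (huv : H1.restrict outer_subset u = v)
    (hu : IsDirichletSolution α 0 (outerTrace v) (H1.restrict (ball_subset_of hBD) u)) :
    l₀ α k v = massForm k u := by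
  rw [massForm_split hD hBD hk, l₀, boundaryDatum_eq hα (MemLp.restrict_ball hBD hk) hu, huv]
  ring

lemma ae_restrict_iff_split (hD : IsOpen D) (hBD : closedBall x₀ R ⊆ D) {p : Plane → Prop}
    (h1 : ∀ᵐ x ∂(volume.restrict (ball x₀ R)), p x)
    (h2 : ∀ᵐ x ∂(volume.restrict (D \ closedBall x₀ R)), p x) :
    ∀ᵐ x ∂(volume.restrict D), p x := by
  rw [restrict_eq_add hD hBD]
  exact ae_add_measure_iff.2 ⟨h1, h2⟩

lemma extendToDomain_ae_eq (hD : IsOpen D) (hα : 0 < α) (hBD : closedBall x₀ R ⊆ D)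
    {h : Plane → ℝ} (hh : MemLp h 2 (volume.restrict D)) {v : VR D x₀ R} {u : H1 D}
    (huv : H1.restrict outer_subset u = v)
    (hu : IsDirichletSolution α h (outerTrace v) (H1.restrict (ball_subset_of hBD) u)) :
    extendToDomain α h v =ᵐ[volume.restrict D] u.fn := by
  refine ae_restrict_iff_split hD hBD ?_ ?_
  · have h1 : interiorSol α h (outerTrace v) = H1.restrict (ball_subset_of hBD) u :=
      (interiorSol_spec hα (MemLp.restrict_ball hBD hh) ⟨_, hu.trace⟩).unique hα
        (MemLp.restrict_ball hBD hh) hu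
    filter_upwards [ae_restrict_mem measurableSet_ball,
      H1.fn_restrict (ball_subset_of hBD) u] with x hx h2
    rw [extendToDomain, if_pos hx, h1, h2]
  · filter_upwards [ae_restrict_mem (hD.measurableSet.diff isClosed_closedBall.measurableSet),
      H1.fn_restrict outer_subset u] with x hx h2
    rw [extendToDomain, if_neg fun hb => hx.2 (ball_subset_closedBall hb), ← huv, h2]

/-- The extension is affine: its linear part is the extension operator. -/
lemma extendToDomain_add_ae_eq (hD : IsOpen D) (hDfin : volume D ≠ ⊤) (hα : 0 < α) (hR : 0 < R)
    (hBD : closedBall x₀ R ⊆ D) {h : Plane → ℝ} (hh : MemLp h 2 (volume.restrict D))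
    {E : VR D x₀ R →L[ℝ] H1 D} (hE : ∀ v, H1.restrict outer_subset (E v) = v ∧
      IsDirichletSolution α 0 (outerTrace v) (H1.restrict (ball_subset_of hBD) (E v)))
    {v₀ : VR D x₀ R} {u : H1 D} (huv : H1.restrict outer_subset u = v₀)
    (hu : IsDirichletSolution α h (outerTrace v₀) (H1.restrict (ball_subset_of hBD) u))
    (φ : VR D x₀ R) :
    extendToDomain α h (v₀ + φ) =ᵐ[volume.restrict D] fun x => u.fn x + (E φ).fn x := by
  have h1 : H1.restrict outer_subset (u + E φ) = v₀ + φ := by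
    rw [H1.restrict_add, huv, (hE φ).1]
  have h2 : IsDirichletSolution α h (outerTrace (v₀ + φ))
      (H1.restrict (ball_subset_of hBD) (u + E φ)) := by
    refine ⟨by rw [← h1]; exact isInnerTrace_restrict hD hDfin hR hBD _, fun η hη => ?_⟩
    rw [← energyL_apply, H1.restrict_add, energyL_add_left, hu.energy hη, (hE φ).2.energy hη,
      massForm_zero, _root_.add_zero]
  exact (extendToDomain_ae_eq hD hα hBD hh h1 h2).trans (H1.fn_add u (E φ))

end truncated

/-! ### Superposition operators and the cost functional -/

section superposition

/-- The Carathéodory argument: clear for simple `u`, then pass to the limit by continuity in the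
second variable. -/
lemma aestronglyMeasurable_superposition {μ : Measure Plane} {g : Plane → ℝ → ℝ}
    (hg : ∀ s, AEStronglyMeasurable (fun x => g x s) μ) (hc : ∀ᵐ x ∂μ, Continuous (g x))
    {u : Plane → ℝ} (hu : AEStronglyMeasurable u μ) :
    AEStronglyMeasurable (fun x => g x (u x)) μ := by
  have hsimple : ∀ φ : SimpleFunc Plane ℝ, AEStronglyMeasurable (fun x => g x (φ x)) μ := by
    intro φ
    have h1 : (fun x => g x (φ x))
        = fun x => ∑ c ∈ φ.range, (φ ⁻¹' {c}).indicator (fun x => g x c) x := by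
      ext x
      rw [Finset.sum_eq_single (φ x)]
      · rw [indicator_of_mem (by simp)]
      · intro c _ hcx
        exact indicator_of_notMem (fun h => hcx (by simpa using h.symm)) _
      · exact fun h => absurd (φ.mem_range_self x) h
    rw [h1]
    exact Finset.aestronglyMeasurable_fun_sum _ fun c _ =>
      (hg c).indicator (φ.measurableSet_fiber c)
  have h2 : AEStronglyMeasurable (fun x => g x (hu.mk u x)) μ := by
    refine aestronglyMeasurable_of_tendsto_ae Filter.atTop
      (fun n => hsimple (hu.stronglyMeasurable_mk.approx n)) ?_
    filter_upwards [hc] with x hx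
    exact (hx.tendsto _).comp (hu.stronglyMeasurable_mk.tendsto_approx x)
  refine h2.congr ?_
  filter_upwards [hu.ae_eq_mk] with x hx
  rw [hx]

lemma aestronglyMeasurable_deriv_superposition {μ : Measure Plane} {g : Plane → ℝ → ℝ}
    (hg : ∀ s, AEStronglyMeasurable (fun x => g x s) μ) (hc : ∀ᵐ x ∂μ, ContDiff ℝ 1 (g x))
    {u : Plane → ℝ} (hu : AEStronglyMeasurable u μ) :
    AEStronglyMeasurable (fun x => deriv (g x) (u x)) μ := by
  refine aestronglyMeasurable_superposition (g := fun x => deriv (g x)) (fun s => ?_)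
    (hc.mono fun x hx => hx.continuous_deriv le_rfl) hu
  -- For fixed `s` the derivative is a limit of difference quotients along the nonzero steps
  -- `1/(n+1)`.
  refine aestronglyMeasurable_of_tendsto_ae Filter.atTop (f := fun (n : ℕ) x =>
    (1 / ((n : ℝ) + 1))⁻¹ * (g x (s + 1 / ((n : ℝ) + 1)) - g x s))
    (fun n => ((hg _).sub (hg _)).const_mul _) ?_
  filter_upwards [hc] with x hx
  have h1 : HasDerivAt (g x) (deriv (g x) s) s := (hx.differentiable one_ne_zero s).hasDerivAt
  have h2 := h1.tendsto_slope_zero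
  refine h2.comp (tendsto_nhdsWithin_iff.2 ⟨tendsto_one_div_add_atTop_nhds_zero_nat, ?_⟩)
  exact Filter.Eventually.of_forall fun n => by
    have : (0 : ℝ) < 1 / ((n : ℝ) + 1) := by positivity
    exact this.ne'

/-- First order Taylor estimate for functions with Lipschitz derivative. -/
lemma abs_taylor_le {f : ℝ → ℝ} (hf : ContDiff ℝ 1 f) {M : ℝ≥0} (hM : LipschitzWith M (deriv f))
    (s t : ℝ) : |f (s + t) - f s - deriv f s * t| ≤ M * t ^ 2 := by
  have hd : ∀ τ, HasDerivAt (fun τ => f (s + τ) - deriv f s * τ)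
      (deriv f (s + τ) - deriv f s) τ := fun τ => by
    have h1 : HasDerivAt (fun τ => f (s + τ)) (deriv f (s + τ)) τ :=
      ((hf.differentiable one_ne_zero (s + τ)).hasDerivAt).comp_const_add s τ
    have h2 : HasDerivAt (fun τ => deriv f s * τ) (deriv f s) τ := by
      simpa using (hasDerivAt_id τ).const_mul (deriv f s)
    exact h1.sub h2
  -- The mean value inequality with this bound yields `M t²` instead of the sharp `M t²/2`; only the
  -- quadratic order matters.
  have hb : ∀ τ ∈ uIcc 0 t, ‖deriv f (s + τ) - deriv f s‖ ≤ M * |t| := fun τ hτ => by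
    have h1 := hM.dist_le_mul (s + τ) s
    rw [Real.dist_eq, Real.dist_eq, add_sub_cancel_left] at h1
    refine h1.trans (mul_le_mul_of_nonneg_left ?_ M.2)
    have h2 := abs_sub_left_of_mem_uIcc hτ
    simpa using h2
  have h := (convex_uIcc 0 t).norm_image_sub_le_of_norm_hasDerivWithin_le
    (fun τ _ => (hd τ).hasDerivWithinAt) hb left_mem_uIcc right_mem_uIcc
  have e : f (s + t) - deriv f s * t - (f (s + 0) - deriv f s * 0)
      = f (s + t) - f s - deriv f s * t := by
    rw [add_zero]; ring
  rw [e, Real.norm_eq_abs, Real.norm_eq_abs, sub_zero] at h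
  calc _ ≤ _ := h
    _ = M * t ^ 2 := by rw [mul_assoc, abs_mul_abs_self, sq]

variable {D : Set Plane} {g : Plane → ℝ → ℝ} {M : ℝ≥0}

/-- The Lipschitz bound gives linear growth: `|g_s(x,s)| ≤ |g_s(x,0)| + M|s|`. -/
lemma memLp_deriv_superposition (hD : IsOpen D)
    (hgmeas : ∀ s : ℝ, AEStronglyMeasurable (fun x => g x s) (volume.restrict D))
    (H1g : ∀ x ∈ D, ContDiff ℝ 1 (g x)) (H2g : ∀ x ∈ D, LipschitzWith M (deriv (g x)))
    (H3g' : MemLp (fun x => deriv (g x) 0) 2 (volume.restrict D)) {u : Plane → ℝ}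
    (hu : MemLp u 2 (volume.restrict D)) :
    MemLp (fun x => deriv (g x) (u x)) 2 (volume.restrict D) := by
  have hm := aestronglyMeasurable_deriv_superposition hgmeas
    ((ae_restrict_mem hD.measurableSet).mono H1g) hu.1
  refine (H3g'.norm.add (hu.norm.const_mul (M : ℝ))).mono hm ?_
  filter_upwards [ae_restrict_mem hD.measurableSet] with x hx
  have h1 := (H2g x hx).dist_le_mul (u x) 0
  rw [Real.dist_eq, Real.dist_eq, sub_zero] at h1
  have h2 : |deriv (g x) (u x)| ≤ |deriv (g x) 0| + M * |u x| := by
    have := abs_add_le (deriv (g x) (u x) - deriv (g x) 0) (deriv (g x) 0)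
    rw [sub_add_cancel] at this
    linarith
  simp only [Pi.add_apply, Real.norm_eq_abs]
  exact h2.trans (le_abs_self _)

/-- Taylor's estimate at `s = 0` bounds `|g(x,s)|` by `|g(x,0)| + |g_s(x,0) s| + M s²`. -/
lemma integrable_superposition (hD : IsOpen D)
    (hgmeas : ∀ s : ℝ, AEStronglyMeasurable (fun x => g x s) (volume.restrict D))
    (H1g : ∀ x ∈ D, ContDiff ℝ 1 (g x)) (H2g : ∀ x ∈ D, LipschitzWith M (deriv (g x)))
    (H3g' : MemLp (fun x => deriv (g x) 0) 2 (volume.restrict D))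
    (H3g : Integrable (fun x => g x 0) (volume.restrict D)) {u : Plane → ℝ}
    (hu : MemLp u 2 (volume.restrict D)) :
    Integrable (fun x => g x (u x)) (volume.restrict D) := by
  have hm := aestronglyMeasurable_superposition hgmeas
    ((ae_restrict_mem hD.measurableSet).mono fun x hx => (H1g x hx).continuous) hu.1
  refine ((H3g.abs.add (integrable_mul_of_L2 H3g' hu).abs).add
    (hu.integrable_sq.const_mul (M : ℝ))).mono' hm ?_
  filter_upwards [ae_restrict_mem hD.measurableSet] with x hx
  have h1 := abs_taylor_le (H1g x hx) (H2g x hx) 0 (u x)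
  rw [zero_add] at h1
  simp only [Pi.add_apply, Real.norm_eq_abs]
  have h2 := abs_add_le (g x (u x) - g x 0 - deriv (g x) 0 * u x) (g x 0 + deriv (g x) 0 * u x)
  have h3 := abs_add_le (g x 0) (deriv (g x) 0 * u x)
  have e : g x (u x) - g x 0 - deriv (g x) 0 * u x + (g x 0 + deriv (g x) 0 * u x)
      = g x (u x) := by ring
  rw [e] at h2
  linarith

lemma massForm_fn_self_le (u : H1 D) : massForm u.fn u ≤ ‖u‖ ^ 2 := by
  rw [H1.norm_sq]
  exact le_add_of_nonneg_right (gradForm_self_nonneg u)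

lemma integral_const_mul_fn_sq_le (c : ℝ≥0) (u : H1 D) {r : ℝ} (hr : ‖u‖ ≤ r) :
    ∫ x in D, c * (u.fn x) ^ 2 ≤ c * r ^ 2 := by
  have e : ∫ x in D, c * (u.fn x) ^ 2 = c * massForm u.fn u := by
    rw [integral_const_mul]
    simp only [massForm, sq]
  rw [e]
  exact mul_le_mul_of_nonneg_left ((massForm_fn_self_le u).trans
    (pow_le_pow_left₀ (norm_nonneg u) hr 2)) c.2

lemma norm_integral_superposition_remainder_le (hD : IsOpen D)
    (hgmeas : ∀ s : ℝ, AEStronglyMeasurable (fun x => g x s) (volume.restrict D))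
    (H1g : ∀ x ∈ D, ContDiff ℝ 1 (g x)) (H2g : ∀ x ∈ D, LipschitzWith M (deriv (g x)))
    (H3g' : MemLp (fun x => deriv (g x) 0) 2 (volume.restrict D))
    (H3g : Integrable (fun x => g x 0) (volume.restrict D)) {u w : Plane → ℝ}
    (hu : MemLp u 2 (volume.restrict D)) (hw : MemLp w 2 (volume.restrict D)) :
    ‖(∫ x in D, g x (u x + w x)) - (∫ x in D, g x (u x)) - ∫ x in D, deriv (g x) (u x) * w x‖
      ≤ ∫ x in D, M * (w x) ^ 2 := by
  have i0 : Integrable (fun x => g x (u x)) (volume.restrict D) :=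
    integrable_superposition hD hgmeas H1g H2g H3g' H3g hu
  have i1 : Integrable (fun x => g x (u x + w x)) (volume.restrict D) :=
    integrable_superposition hD hgmeas H1g H2g H3g' H3g (hu.add hw)
  have i2 : Integrable (fun x => g x (u x + w x) - g x (u x)) (volume.restrict D) := i1.sub i0
  have i3 : Integrable (fun x => deriv (g x) (u x) * w x) (volume.restrict D) :=
    integrable_mul_of_L2 (memLp_deriv_superposition hD hgmeas H1g H2g H3g' hu) hw
  rw [← integral_sub i1 i0, ← integral_sub i2 i3]
  refine norm_integral_le_of_norm_le (hw.integrable_sq.const_mul _) ?_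
  filter_upwards [ae_restrict_mem hD.measurableSet] with x hx
  exact abs_taylor_le (H1g x hx) (H2g x hx) (u x) (w x)

/-- The cost functional is Fréchet differentiable; its derivative is the integral of `g_s` against
the extension. -/
theorem hasFDerivAt_J₀ {x₀ : Plane} {R α : ℝ} (hD : IsOpen D) (hDfin : volume D ≠ ⊤) (hα : 0 < α)
    (hR : 0 < R) (hBD : closedBall x₀ R ⊆ D) {h : Plane → ℝ} (hh : MemLp h 2 (volume.restrict D))
    (hgmeas : ∀ s : ℝ, AEStronglyMeasurable (fun x => g x s) (volume.restrict D))
    (H1g : ∀ x ∈ D, ContDiff ℝ 1 (g x)) (H2g : ∀ x ∈ D, LipschitzWith M (deriv (g x)))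
    (H3g' : MemLp (fun x => deriv (g x) 0) 2 (volume.restrict D))
    (H3g : Integrable (fun x => g x 0) (volume.restrict D))
    {E : VR D x₀ R →L[ℝ] H1 D} (hE : ∀ v, H1.restrict outer_subset (E v) = v ∧
      IsDirichletSolution α 0 (outerTrace v) (H1.restrict (ball_subset_of hBD) (E v)))
    {v₀ : VR D x₀ R} {u : H1 D} (huv : H1.restrict outer_subset u = v₀)
    (hu : IsDirichletSolution α h (outerTrace v₀) (H1.restrict (ball_subset_of hBD) u)) :
    HasFDerivAt (J₀ α h g : VR D x₀ R → ℝ)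
      ((massL (memLp_deriv_superposition hD hgmeas H1g H2g H3g' u.memLp_fn)).comp E) v₀ := by
  set hk := memLp_deriv_superposition hD hgmeas H1g H2g H3g' u.memLp_fn
  have hJ0 : J₀ α h g v₀ = ∫ x in D, g x (u.fn x) := by
    refine integral_congr_ae ?_
    filter_upwards [extendToDomain_ae_eq hD hα hBD hh huv hu] with x hx
    rw [hx]
  have hJ : ∀ φ, J₀ α h g (v₀ + φ) = ∫ x in D, g x (u.fn x + (E φ).fn x) := fun φ => by
    refine integral_congr_ae ?_
    filter_upwards [extendToDomain_add_ae_eq hD hDfin hα hR hBD hh hE huv hu φ] with x hx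
    rw [hx]
  -- The extension is affine with bounded linear part `E`, and the Taylor remainder is at most `M ∫
  -- (Eφ)²`. It is thus quadratic in `‖φ‖`, and no Sobolev embedding is used.
  have hbound : ∀ φ : VR D x₀ R,
      ‖J₀ α h g (v₀ + φ) - J₀ α h g v₀ - ((massL hk).comp E) φ‖ ≤ M * ‖E‖ ^ 2 * ‖‖φ‖ ^ 2‖ := by
    intro φ
    have e1 : ((massL hk).comp E) φ = ∫ x in D, deriv (g x) (u.fn x) * (E φ).fn x :=
      massL_apply hk (E φ)
    have e2 := norm_integral_superposition_remainder_le hD hgmeas H1g H2g H3g' H3g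
      u.memLp_fn (E φ).memLp_fn
    have e3 : ‖E φ‖ ≤ ‖E‖ * ‖φ‖ := E.le_opNorm φ
    have e4 := integral_const_mul_fn_sq_le M (E φ) e3
    rw [mul_pow, ← mul_assoc] at e4
    have e5 : ‖‖φ‖ ^ 2‖ = ‖φ‖ ^ 2 := Real.norm_of_nonneg (sq_nonneg _)
    rw [hJ, hJ0, e1, e5]
    exact e2.trans e4
  rw [hasFDerivAt_iff_isLittleO_nhds_zero]
  exact (Asymptotics.IsBigO.of_bound (M * ‖E‖ ^ 2) (Filter.Eventually.of_forall hbound)).trans_isLittleO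
    (Asymptotics.isLittleO_norm_pow_id one_lt_two)

end superposition

end

/-! ### Assembly of the theorem -/

theorem mainTheorem6
    (D : Set Plane) (hD : IsOpen D) (hDfin : volume D ≠ ⊤)
    (α : ℝ) (hα : 0 < α)
    (x₀ : Plane) (R : ℝ) (hR : 0 < R) (hBD : closedBall x₀ R ⊆ D)
    (h : Plane → ℝ) (hh : MemLp h 2 (volume.restrict D))
    (g : Plane → ℝ → ℝ)
    (hgmeas : ∀ s : ℝ, AEStronglyMeasurable (fun x => g x s) (volume.restrict D))
    (H1g : ∀ x ∈ D, ContDiff ℝ 1 (g x))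
    (M : ℝ≥0) (H2g : ∀ x ∈ D, LipschitzWith M (deriv (g x)))
    (H3g' : MemLp (fun x => deriv (g x) 0) 2 (volume.restrict D))
    (p : ℝ≥0∞) (hp : 1 < p) (H3g : MemLp (fun x => g x 0) p (volume.restrict D)) :
    -- the trace, the interior problem and hence `T₀` are well defined
    (∀ v : VR D x₀ R, ∃ φ ∈ HHalf x₀ R, ∀ f : L2Circle x₀ R, IsOuterTrace v f ↔ f = φ) ∧
    (∀ k : Plane → ℝ, MemLp k 2 (volume.restrict (ball x₀ R)) → ∀ φ ∈ HHalf x₀ R,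
      ∃! u : H1 (ball x₀ R), IsDirichletSolution α k φ u) ∧
    -- the two direct problems are well posed
    (∃! v' : H1 D, IsNeumannSolution α D h v') ∧
    (∃! v₀ : VR D x₀ R, IsExteriorSolution α h v₀) ∧
    ∀ (v' : H1 D) (v₀ : VR D x₀ R), IsNeumannSolution α D h v' → IsExteriorSolution α h v₀ →
      -- the two adjoint problems are well posed
      DifferentiableAt ℝ (J₀ α h g : VR D x₀ R → ℝ) v₀ ∧
      (∃! w' : H1 D, IsNeumannSolution α D (fun x => -deriv (g x) (v'.fn x)) w') ∧
      (∃! w₀ : VR D x₀ R, IsAdjointState α h g v₀ w₀) ∧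
      -- the adjoint state is the solution of the truncated adjoint boundary value problem
      (∀ w₀ : VR D x₀ R, IsAdjointState α h g v₀ w₀ ↔
        IsExteriorSolution α (fun x => -deriv (g x) (extendToDomain α h v₀ x)) w₀) ∧
      -- the adjoint state is the restriction of the adjoint on the whole domain
      ∀ (w' : H1 D) (w₀ : VR D x₀ R),
        IsNeumannSolution α D (fun x => -deriv (g x) (v'.fn x)) w' →
        IsAdjointState α h g v₀ w₀ →
        w₀ = H1.restrict (sdiff_subset : D \ closedBall x₀ R ⊆ D) w' := by
  have : IsFiniteMeasure (volume.restrict D) :=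
    ⟨by rw [Measure.restrict_apply_univ]; exact hDfin.lt_top⟩
  -- Finite measure turns `L^p` into `L¹`, which is all that the cost functional needs.
  have H3 : Integrable (fun x => g x 0) (volume.restrict D) := H3g.integrable hp.le
  refine ⟨fun v => ⟨outerTrace v, outerTrace_mem_HHalf hD hDfin hR hBD v, fun f => ⟨fun hf =>
    (outerTrace_eq hD hR hBD hf).symm, fun hf => hf ▸ isOuterTrace_outerTrace hD hDfin hR hBD v⟩⟩,
    fun k hk φ hφ => existsUnique_isDirichletSolution hα hk hφ,
    existsUnique_isNeumannSolution hα hh,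
    existsUnique_isExteriorSolution hD hDfin hα hR hBD hh, fun v' v₀ hv' hv₀ => ?_⟩
  -- Uniqueness on `D` identifies `v'` with the Neumann solution behind `v₀`; hence the extension of
  -- `v₀` agrees almost everywhere with `v'`.
  have hvv : H1.restrict outer_subset v' = v₀ := by
    obtain ⟨u, hu, huv⟩ := (isExteriorSolution_iff hD hDfin hα hR hBD hh v₀).1 hv₀
    rw [(existsUnique_isNeumannSolution hα hh).unique hv' hu, huv]
  have hdir : IsDirichletSolution α h (outerTrace v₀)
      (H1.restrict (ball_subset_of hBD) v') := by
    have := hv'.isDirichletSolution_restrict hD hDfin hR hBD hh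
    rwa [hvv] at this
  have hext := extendToDomain_ae_eq hD hα hBD hh hvv hdir
  obtain ⟨E, hE⟩ := exists_extensionOperator (x₀ := x₀) hD hDfin hα hR hBD
  have hder := hasFDerivAt_J₀ hD hDfin hα hR hBD hh hgmeas H1g H2g H3g' H3 hE hvv hdir
  have hk' := memLp_deriv_superposition hD hgmeas H1g H2g H3g' v'.memLp_fn
  have hkk : (fun x => -deriv (g x) (v'.fn x))
      =ᵐ[volume.restrict D] fun x => -deriv (g x) (extendToDomain α h v₀ x) := by
    filter_upwards [hext] with x hx
    rw [hx]
  have hk : MemLp (fun x => -deriv (g x) (extendToDomain α h v₀ x)) 2 (volume.restrict D) :=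
    hk'.neg.ae_eq hkk
  have hadj : ∀ w₀ : VR D x₀ R, IsAdjointState α h g v₀ w₀ ↔
      IsExteriorSolution α (fun x => -deriv (g x) (extendToDomain α h v₀ x)) w₀ := by
    intro w₀
    refine forall_congr' fun φ => ?_
    -- Both sides are the integral over `D` of `-g_s` at the direct state against `Eφ`: the left by
    -- differentiation, the right by reciprocity.
    have e1 : -(fderiv ℝ (J₀ α h g) v₀ φ)
        = l₀ α (fun x => -deriv (g x) (extendToDomain α h v₀ x)) φ := by
      rw [l₀_eq_massForm hD hα hBD hk (hE φ).1 (hE φ).2, ← massForm_congr hkk, hder.fderiv]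
      have e2 : ((massL hk').comp E) φ = massForm (fun x => deriv (g x) (v'.fn x)) (E φ) :=
        massL_apply hk' (E φ)
      refine (congrArg Neg.neg e2).trans ?_
      simp only [massForm, neg_mul, integral_neg]
    rw [e1]
  have hwell := existsUnique_isExteriorSolution (x₀ := x₀) hD hDfin hα hR hBD hk
  refine ⟨hder.differentiableAt, existsUnique_isNeumannSolution hα hk'.neg, ?_, hadj,
    fun w' w₀ hw' hw₀ => ?_⟩
  · simpa only [hadj] using hwell
  · exact hwell.unique ((hadj w₀).1 hw₀)
      ((isExteriorSolution_iff hD hDfin hα hR hBD hk _).2 ⟨w', hw'.congr hkk, rfl⟩)
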